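/- **Proposition 3.3.** Let $(M^{2n},J)$ be a complex manifold and let $(\omega_t,\beta_t)$, $t$ in an interval $\mathcal I\subset\mathbb R$ with more than one point, be a smooth solution of pluriclosed flow, $$\partial_t\omega=-\rho_B^{1,1},\qquad \partial_t\beta=-\rho_B^{2,0},$$ where $\omega=\sqrt{-1}\,g_{i\bar j}\,dz^i\wedge d\bar z^j$ is the fundamental form of a Hermitian metric $g=g_t$, $\rho_B=\sqrt{-1}\,\mathrm{tr}_{T^{1,0}}\Omega^B$ is the trace of the curvature of the Bismut connection of $g$ (the unique Hermitian connection with skew-symmetric torsion), and $\beta=\frac12\beta_{ij}\,dz^i\wedge dz^j$ is a $(2,0)$-form with $\partial\omega+\bar\partial\beta=0$. For a Hermitian metric $g$ and a $(2,0)$-form $\beta$, the generalized metric $G=G(g,\beta)$ is the Hermitian metric on $T^{1,0}\oplus\Lambda^{1,0}$ given in the frame $Z^i=\partial/\partial z^i$, $W^i=dz^i$ by $$G_{Z^i\bar Z^j}=g_{i\bar j}+\beta_{ik}\bar\beta_{\bar j\bar l}g^{\bar lk},\quad G_{Z^i\bar W^j}=g^{\bar jp}\beta_{ip},\quad G_{W^i\bar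 Z^j}=g^{\bar pi}\bar\beta_{\bar j\bar p},\quad G_{W^i\bar W^j}=g^{\bar ji}.$$ Let $G=G(g_t,\beta_t)$ and let $\tilde G=G(\tilde g,\tilde\beta)$, where $\tilde g$ is a fixed smooth Hermitian metric and $\tilde\beta$ a fixed smooth $(2,0)$-form. Lower case indices refer to the coordinate frame of $T^{1,0}$, capital ones to the frame $(Z^i,W^i)$. A Hermitian metric $h$ on either bundle has Chern connection $\Gamma_{iA}^B=\partial_ih_{A\bar C}\,h^{\bar CB}$ and curvature $\Omega_{i\bar jA}^B=-\partial_{\bar j}\Gamma_{iA}^B$. Let $T_{ij}^k$ be the torsion of the Chern connection of $g$, $T_{ij\bar k}=T_{ij}^pg_{p\bar k}$, let $\Upsilon_{iA}^B$ be the components of $\nabla^G-\nabla^{\tilde G}$ and $(\Upsilon^g)_{ij}^k$ those of $\nabla^g-\nabla^{\tilde g}$, and let $\tilde\Omega$ be the Chern curvature of $\tilde G$. On a tensor with indices of both kinds, $\nabla$ (resp. $\tilde\nabla$) uses the Chern connection of $g$ (resp. $\tilde g$) on lower case indices and that of $G$ (resp. $\tilde G$) on capital ones. Write $\Delta=g^{\bar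 kl}\nabla_l\nabla_{\bar k}$ and $\langle\Phi,\Psi\rangle=g^{\bar ji}G^{\bar CA}G_{B\bar D}\Phi_{iA}^B\overline{\Psi_{jC}^D}$, $|\Upsilon|^2=\langle\Upsilon,\Upsilon\rangle$; the norms of $\nabla\Upsilon$ and $\bar\nabla\Upsilon$ are formed in the same way, with $g$ on the additional index. Put $(T\cdot\Upsilon)_{\bar kiA}^B=g^{\bar qp}\,\overline{T_{qk\bar i}}\,\Upsilon_{pA}^B$. Then at every point of $M$ and every $t\in\mathcal I$ (with the one-sided time derivative at an end point of $\mathcal I$) $$\left(\partial_t-\Delta\right)|\Upsilon|^2=-|\nabla\Upsilon|^2-|\bar\nabla\Upsilon+T\cdot\Upsilon|^2+T*\Upsilon*\tilde\Omega+\Upsilon*\bar\Upsilon*\tilde\Omega+\Upsilon*\tilde\nabla\tilde\Omega,$$ where the last three terms are $$T*\Upsilon*\tilde\Omega=2\,\mathrm{Re}\,\big\langle g^{\bar kl}T_{il}^p\tilde\Omega_{p\bar kA}^B,\ \Upsilon_{iA}^B\big\rangle,$$ $$\Upsilon*\bar\Upsilon*\tilde\Omega=2\,\mathrm{Re}\,\big\langle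 g^{\bar kl}\big((\Upsilon^g)_{li}^p\tilde\Omega_{p\bar kA}^B+\Upsilon_{lA}^C\tilde\Omega_{i\bar kC}^B-\Upsilon_{lC}^B\tilde\Omega_{i\bar kA}^C\big),\ \Upsilon_{iA}^B\big\rangle,$$ $$\Upsilon*\tilde\nabla\tilde\Omega=-2\,\mathrm{Re}\,\big\langle g^{\bar kl}\tilde\nabla_l\tilde\Omega_{i\bar kA}^B,\ \Upsilon_{iA}^B\big\rangle.$$ -/

import Mathlib

open scoped Manifold ContDiff ComplexConjugate

noncomputable section

namespace PCF

/-! ## Calculus on `ℂⁿ` -/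

/-- The model space `ℂⁿ`. -/
abbrev Cn (n : ℕ) : Type := Fin n → ℂ

/-- The frame index `A` of `T^{1,0} ⊕ Λ^{1,0}`: `Sum.inl i` stands for `Z^i = ∂/∂z^i` and
`Sum.inr i` stands for `W^i = dz^i`. -/
abbrev GIdx (n : ℕ) : Type := Fin n ⊕ Fin n

/-- The Wirtinger derivative `∂_k f = (∂f/∂x^k - √-1 ∂f/∂y^k) / 2`. -/
def dz {n : ℕ} (k : Fin n) (f : Cn n → ℂ) (z : Cn n) : ℂ :=
  (fderiv ℝ f z (Pi.single k 1) - Complex.I * fderiv ℝ f z (Pi.single k Complex.I)) / 2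

/-- The Wirtinger derivative `∂_{k̄} f = (∂f/∂x^k + √-1 ∂f/∂y^k) / 2`. -/
def dzbar {n : ℕ} (k : Fin n) (f : Cn n → ℂ) (z : Cn n) : ℂ :=
  (fderiv ℝ f z (Pi.single k 1) + Complex.I * fderiv ℝ f z (Pi.single k Complex.I)) / 2

/-! ## Hermitian matrices: Chern connections

A Hermitian metric `h` on a holomorphic bundle, in a holomorphic frame, is the matrix function
`h z A C = h_{A C̄}`. Its matrix inverse has the entries `(h z)⁻¹ C B = h^{C̄ B}`, so that
`∑_C h_{A C̄} h^{C̄ B} = δ_A^B`. -/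

/-- Chern connection `Γ_{iA}^B = (∂_i h_{A C̄}) h^{C̄ B}`, that is `∇_i e_A = Γ_{iA}^B e_B`. -/
def chern {n : ℕ} {ι : Type} [Fintype ι] [DecidableEq ι] (h : Cn n → Matrix ι ι ℂ)
    (i : Fin n) (A B : ι) (z : Cn n) : ℂ :=
  ∑ C, dz i (fun w => h w A C) z * (h z)⁻¹ C B

/-- Chern curvature `Ω_{i j̄ A}^B = -∂_{j̄} Γ_{iA}^B`. -/
def chernCurv {n : ℕ} {ι : Type} [Fintype ι] [DecidableEq ι] (h : Cn n → Matrix ι ι ℂ)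
    (i j : Fin n) (A B : ι) (z : Cn n) : ℂ :=
  -dzbar j (fun w => chern h i A B w) z

/-- Difference of the Chern connections, `Υ_{iA}^B = Γ(h)_{iA}^B - Γ(h')_{iA}^B`. -/
def upsilon {n : ℕ} {ι : Type} [Fintype ι] [DecidableEq ι] (h h' : Cn n → Matrix ι ι ℂ)
    (i : Fin n) (A B : ι) (z : Cn n) : ℂ :=
  chern h i A B z - chern h' i A B z

/-- Covariant derivative `∇_l Φ_{iA}^B` in the direction `∂_l` of a section `Φ_{iA}^B` of
`Λ^{1,0} ⊗ End`, with the Chern connection of `g` on the index `i` and that of `h` on `A`, `B`.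
(Chern connections have no mixed coefficients, so a further lower barred index on `Φ` does not
contribute.) -/
def nabla {n : ℕ} {ι : Type} [Fintype ι] [DecidableEq ι] (g : Cn n → Matrix (Fin n) (Fin n) ℂ)
    (h : Cn n → Matrix ι ι ℂ) (l : Fin n) (Φ : Fin n → ι → ι → Cn n → ℂ)
    (i : Fin n) (A B : ι) (z : Cn n) : ℂ :=
  dz l (Φ i A B) z - ∑ p, chern g l i p z * Φ p A B z
    - ∑ C, chern h l A C z * Φ i C B z + ∑ C, chern h l C B z * Φ i A C z

/-- Covariant derivative `∇_{k̄} Φ_{iA}^B` in the direction `∂_{k̄}`: since Chern connections have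
no mixed coefficients, it is the componentwise `∂_{k̄}`. -/
def nablaBar {n : ℕ} {ι : Type} (k : Fin n) (Φ : Fin n → ι → ι → Cn n → ℂ)
    (i : Fin n) (A B : ι) (z : Cn n) : ℂ :=
  dzbar k (Φ i A B) z

/-- The pairing `⟨Φ, Ψ⟩ = g^{j̄ i} h^{C̄ A} h_{B D̄} Φ_{iA}^B conj(Ψ_{jC}^D)` at a point, for
Hermitian matrices `g`, `h`. -/
def pairing {n : ℕ} {ι : Type} [Fintype ι] [DecidableEq ι] (g : Matrix (Fin n) (Fin n) ℂ)
    (h : Matrix ι ι ℂ) (Φ Ψ : Fin n → ι → ι → ℂ) : ℂ :=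
  ∑ i, ∑ j, ∑ A, ∑ B, ∑ C, ∑ D, g⁻¹ j i * h⁻¹ C A * h B D * Φ i A B * conj (Ψ j C D)

/-- `|Φ|² = g^{m̄ l} ⟨Φ_l, Φ_m⟩` for a tensor `Φ_{l i A}^B` with a further unbarred index `l`. -/
def normSqHol {n : ℕ} {ι : Type} [Fintype ι] [DecidableEq ι] (g : Matrix (Fin n) (Fin n) ℂ)
    (h : Matrix ι ι ℂ) (Φ : Fin n → Fin n → ι → ι → ℂ) : ℂ :=
  ∑ l, ∑ m, g⁻¹ m l * pairing g h (Φ l) (Φ m)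

/-- `|Φ|² = g^{k̄ m} ⟨Φ_{k̄}, Φ_{m̄}⟩` for a tensor `Φ_{k̄ i A}^B` with a further barred index. -/
def normSqAnti {n : ℕ} {ι : Type} [Fintype ι] [DecidableEq ι] (g : Matrix (Fin n) (Fin n) ℂ)
    (h : Matrix ι ι ℂ) (Φ : Fin n → Fin n → ι → ι → ℂ) : ℂ :=
  ∑ k, ∑ m, g⁻¹ k m * pairing g h (Φ k) (Φ m)

/-- The Laplacian on functions, `Δ f = g^{k̄ l} ∇_l ∇_{k̄} f = g^{k̄ l} ∂_l ∂_{k̄} f`. -/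
def laplacian {n : ℕ} (g : Cn n → Matrix (Fin n) (Fin n) ℂ) (f : Cn n → ℂ) (z : Cn n) : ℂ :=
  ∑ k, ∑ l, (g z)⁻¹ k l * dz l (fun w => dzbar k f w) z

/-! ## Torsion, Bismut connection and Bismut-Ricci form of a Hermitian metric -/

/-- Torsion of the Chern connection, `T_{ij}^k = Γ_{ij}^k - Γ_{ji}^k`. -/
def torsion {n : ℕ} (g : Cn n → Matrix (Fin n) (Fin n) ℂ) (i j k : Fin n) (z : Cn n) : ℂ :=
  chern g i j k z - chern g j i k z

/-- Torsion with lowered index, `T_{ij k̄} = T_{ij}^p g_{p k̄}`. -/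
def torsionLow {n : ℕ} (g : Cn n → Matrix (Fin n) (Fin n) ℂ) (i j k : Fin n) (z : Cn n) : ℂ :=
  ∑ p, torsion g i j p z * g z p k

/-- The coefficients of the Bismut connection in unbarred directions: the connection preserves
`T^{1,0}` and `∇^B_{∂_i} ∂_j = (Γ^B)_{ij}^k ∂_k` with `(Γ^B)_{ij}^k = (∂_j g_{i l̄}) g^{l̄ k}`.
See `bismut_characterization`. -/
def bismutHol {n : ℕ} (g : Cn n → Matrix (Fin n) (Fin n) ℂ) (i j k : Fin n) (z : Cn n) : ℂ :=
  ∑ l, dz j (fun w => g w i l) z * (g z)⁻¹ l k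

/-- The coefficients of the Bismut connection in barred directions:
`∇^B_{∂_{ī}} ∂_j = (Γ^B)_{īj}^k ∂_k` with
`(Γ^B)_{īj}^k = (∂_{ī} g_{j l̄} - ∂_{l̄} g_{j ī}) g^{l̄ k}`.
See `bismut_characterization`. -/
def bismutAnti {n : ℕ} (g : Cn n → Matrix (Fin n) (Fin n) ℂ) (i j k : Fin n) (z : Cn n) : ℂ :=
  ∑ l, (dzbar i (fun w => g w j l) z - dzbar l (fun w => g w j i) z) * (g z)⁻¹ l k

/-- `(Ω^B)_{ija}^b`, the part of the curvature of the Bismut connection on `T^{1,0}` along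
`∂_i, ∂_j`. -/
def bismutCurv20 {n : ℕ} (g : Cn n → Matrix (Fin n) (Fin n) ℂ) (i j a b : Fin n) (z : Cn n) : ℂ :=
  dz i (fun w => bismutHol g j a b w) z - dz j (fun w => bismutHol g i a b w) z
    + ∑ c, (bismutHol g j a c z * bismutHol g i c b z - bismutHol g i a c z * bismutHol g j c b z)

/-- `(Ω^B)_{i j̄ a}^b`, the part of the curvature of the Bismut connection on `T^{1,0}` along
`∂_i, ∂_{j̄}`. -/
def bismutCurv11 {n : ℕ} (g : Cn n → Matrix (Fin n) (Fin n) ℂ) (i j a b : Fin n) (z : Cn n) : ℂ :=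
  dz i (fun w => bismutAnti g j a b w) z - dzbar j (fun w => bismutHol g i a b w) z
    + ∑ c, (bismutAnti g j a c z * bismutHol g i c b z
      - bismutHol g i a c z * bismutAnti g j c b z)

/-- The component `ρ_B(∂_i, ∂_j)` of the Bismut-Ricci form `ρ_B = √-1 tr Ω^B`. -/
def rhoB20 {n : ℕ} (g : Cn n → Matrix (Fin n) (Fin n) ℂ) (i j : Fin n) (z : Cn n) : ℂ :=
  Complex.I * ∑ a, bismutCurv20 g i j a a z

/-- The component `ρ_B(∂_i, ∂_{j̄})` of the Bismut-Ricci form `ρ_B = √-1 tr Ω^B`. -/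
def rhoB11 {n : ℕ} (g : Cn n → Matrix (Fin n) (Fin n) ℂ) (i j : Fin n) (z : Cn n) : ℂ :=
  Complex.I * ∑ a, bismutCurv11 g i j a a z

/-- The component `ω(∂_i, ∂_{j̄}) = √-1 g_{i j̄}` of the fundamental form
`ω = √-1 g_{i j̄} dz^i ∧ dz̄^j`. -/
def fundForm {n : ℕ} (g : Cn n → Matrix (Fin n) (Fin n) ℂ) (i j : Fin n) (z : Cn n) : ℂ :=
  Complex.I * g z i j

/-- The Bismut connection is the unique connection on `T^{1,0}` with coefficients
`P i j k = (Γ^B)_{ij}^k`, `Q i j k = (Γ^B)_{īj}^k` that preserves the metric,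
`∂_i g_{j k̄} = P_{ij}^l g_{l k̄} + conj(Q_{ik}^l) g_{j l̄}`, and has skew-symmetric torsion:
the torsion component `g(Tor(∂_i, ∂_j), ∂_{k̄}) = (P_{ij}^l - P_{ji}^l) g_{l k̄}` equals
`g(Tor(∂_{k̄}, ∂_i), ∂_j) = -conj(Q_{ik}^l) g_{j l̄}`. -/
theorem bismut_characterization {n : ℕ} (g : Cn n → Matrix (Fin n) (Fin n) ℂ)
    (hg : ∀ w, (g w).IsHermitian) (z : Cn n) (hu : IsUnit (g z).det)
    (hd : ∀ i j, DifferentiableAt ℝ (fun w => g w i j) z) (P Q : Fin n → Fin n → Fin n → ℂ) :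
    ((∀ i j k, dz i (fun w => g w j k) z
          = ∑ l, P i j l * g z l k + ∑ l, conj (Q i k l) * g z j l) ∧
      (∀ i j k, ∑ l, (P i j l - P j i l) * g z l k = -∑ l, conj (Q i k l) * g z j l)) ↔
    ((∀ i j k, P i j k = bismutHol g i j k z) ∧ (∀ i j k, Q i j k = bismutAnti g i j k z)) := by
  have hgz : ∀ w i j, conj (g w i j) = g w j i := fun w i j => (hg w).apply j i
  have hconj : ∀ i j k, conj (dz i (fun w => g w j k) z) = dzbar i (fun w => g w k j) z := by
    intro i j k
    have h1 : (fun w => g w k j) = fun w => Complex.conjCLE (g w j k) := by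
      funext w
      simp [hgz]
    have h2 : fderiv ℝ (fun w => g w k j) z
        = (Complex.conjCLE : ℂ →L[ℝ] ℂ).comp (fderiv ℝ (fun w => g w j k) z) := by
      rw [h1]
      exact ((Complex.conjCLE : ℂ →L[ℝ] ℂ).hasFDerivAt.comp z (hd j k).hasFDerivAt).fderiv
    have h3 : conj (2 : ℂ) = 2 := Complex.conj_ofNat 2
    simp [dz, dzbar, h2, h3]
  have hinv : ∀ X Y : Fin n → ℂ,
      (∀ k, ∑ l, X l * g z l k = Y k) ↔ ∀ k, X k = ∑ l, Y l * (g z)⁻¹ l k := by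
    intro X Y
    have e1 : (∀ k, ∑ l, X l * g z l k = Y k) ↔ Matrix.vecMul X (g z) = Y := by
      rw [funext_iff]; rfl
    have e2 : (∀ k, X k = ∑ l, Y l * (g z)⁻¹ l k) ↔ X = Matrix.vecMul Y (g z)⁻¹ := by
      rw [funext_iff]; rfl
    rw [e1, e2]
    constructor
    · rintro rfl
      rw [Matrix.vecMul_vecMul, Matrix.mul_nonsing_inv _ hu, Matrix.vecMul_one]
    · rintro rfl
      rw [Matrix.vecMul_vecMul, Matrix.nonsing_inv_mul _ hu, Matrix.vecMul_one]
  have hQ : ∀ i j k, conj (∑ l, conj (Q i k l) * g z j l) = ∑ l, Q i k l * g z l j := by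
    intro i j k
    simp [map_sum, hgz]
  have hP' : (∀ i j k, P i j k = bismutHol g i j k z) ↔
      ∀ i j k, ∑ l, P i j l * g z l k = dz j (fun w => g w i k) z :=
    forall_congr' fun i => forall_congr' fun j =>
      (hinv (P i j) (fun k => dz j (fun w => g w i k) z)).symm
  have hQ' : (∀ i j k, Q i j k = bismutAnti g i j k z) ↔
      ∀ i j k, ∑ l, Q i j l * g z l k
        = dzbar i (fun w => g w j k) z - dzbar k (fun w => g w j i) z :=
    forall_congr' fun i => forall_congr' fun j =>
      (hinv (Q i j) (fun k => dzbar i (fun w => g w j k) z - dzbar k (fun w => g w j i) z)).symm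
  have hQ2 : (∀ i j k, ∑ l, Q i j l * g z l k
        = dzbar i (fun w => g w j k) z - dzbar k (fun w => g w j i) z) ↔
      ∀ i j k, ∑ l, conj (Q i k l) * g z j l
        = dz i (fun w => g w j k) z - dz j (fun w => g w i k) z := by
    constructor
    · intro h i j k
      apply (starRingEnd ℂ).injective
      rw [hQ, h, map_sub, hconj, hconj]
    · intro h i j k
      rw [← hQ, h, map_sub, hconj, hconj]
  rw [hP', hQ', hQ2]
  simp only [sub_mul, Finset.sum_sub_distrib]
  constructor
  · rintro ⟨h1, h2⟩
    have h3 : ∀ i j k, ∑ l, P i j l * g z l k = dz j (fun w => g w i k) z := by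
      intro i j k
      rw [h1 j i k]
      linear_combination -h2 j i k
    refine ⟨h3, fun i j k => ?_⟩
    linear_combination -h1 i j k - h3 i j k
  · rintro ⟨h1, h2⟩
    refine ⟨fun i j k => ?_, fun i j k => ?_⟩
    · rw [h1, h2]; ring
    · rw [h1, h1, h2]; ring

/-! ## Generalized metrics -/

/-- The generalized metric `G` on `T^{1,0} ⊕ Λ^{1,0}` of a Hermitian metric `g_{i j̄}` and a
`(2,0)`-form `β_{ij}`, in the frame `Z^i = ∂/∂z^i`, `W^i = dz^i`:
`G_{Z^i Z̄^j} = g_{i j̄} + β_{ik} conj(β_{jl}) g^{l̄ k}`, `G_{Z^i W̄^j} = g^{j̄ p} β_{ip}`,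
`G_{W^i Z̄^j} = g^{p̄ i} conj(β_{jp})`, `G_{W^i W̄^j} = g^{j̄ i}`. -/
def genMetric {n : ℕ} (g b : Cn n → Matrix (Fin n) (Fin n) ℂ) (z : Cn n) :
    Matrix (GIdx n) (GIdx n) ℂ :=
  Matrix.fromBlocks
    (Matrix.of fun i j => g z i j + ∑ k, ∑ l, b z i k * conj (b z j l) * (g z)⁻¹ l k)
    (Matrix.of fun i j => ∑ p, (g z)⁻¹ j p * b z i p)
    (Matrix.of fun i j => ∑ p, (g z)⁻¹ p i * conj (b z j p))
    (Matrix.of fun i j => (g z)⁻¹ j i)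

/-! ## The tensors in the evolution equation

Below `g`, `g'` are Hermitian metrics and `h`, `h'` Hermitian metrics on a second bundle; primes
denote the background. -/

/-- `|Υ|² = g^{j̄ i} h^{C̄ A} h_{B D̄} Υ_{iA}^B conj(Υ_{jC}^D)`, where `Υ = Υ(h, h')`. -/
def upsilonNormSq {n : ℕ} {ι : Type} [Fintype ι] [DecidableEq ι]
    (g : Cn n → Matrix (Fin n) (Fin n) ℂ) (h h' : Cn n → Matrix ι ι ℂ) (z : Cn n) : ℂ :=
  pairing (g z) (h z) (fun i A B => upsilon h h' i A B z) (fun i A B => upsilon h h' i A B z)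

/-- `|∇Υ|²`. -/
def gradNormSq {n : ℕ} {ι : Type} [Fintype ι] [DecidableEq ι]
    (g : Cn n → Matrix (Fin n) (Fin n) ℂ) (h h' : Cn n → Matrix ι ι ℂ) (z : Cn n) : ℂ :=
  normSqHol (g z) (h z) (fun l i A B => nabla g h l (upsilon h h') i A B z)

/-- `(T·Υ)_{k̄ i A}^B = g^{q̄ p} conj(T_{qk ī}) Υ_{pA}^B`. -/
def torsionDot {n : ℕ} {ι : Type} [Fintype ι] [DecidableEq ι]
    (g : Cn n → Matrix (Fin n) (Fin n) ℂ) (h h' : Cn n → Matrix ι ι ℂ)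
    (k i : Fin n) (A B : ι) (z : Cn n) : ℂ :=
  ∑ p, ∑ q, (g z)⁻¹ q p * conj (torsionLow g q k i z) * upsilon h h' p A B z

/-- `|∇̄Υ + T·Υ|²`. -/
def gradBarNormSq {n : ℕ} {ι : Type} [Fintype ι] [DecidableEq ι]
    (g : Cn n → Matrix (Fin n) (Fin n) ℂ) (h h' : Cn n → Matrix ι ι ℂ) (z : Cn n) : ℂ :=
  normSqAnti (g z) (h z)
    (fun k i A B => nablaBar k (upsilon h h') i A B z + torsionDot g h h' k i A B z)

/-- `g^{k̄ l} T_{il}^p Ω̃_{p k̄ A}^B`. -/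
def torsionCurv {n : ℕ} {ι : Type} [Fintype ι] [DecidableEq ι]
    (g : Cn n → Matrix (Fin n) (Fin n) ℂ) (h' : Cn n → Matrix ι ι ℂ)
    (i : Fin n) (A B : ι) (z : Cn n) : ℂ :=
  ∑ k, ∑ l, ∑ p, (g z)⁻¹ k l * torsion g i l p z * chernCurv h' p k A B z

/-- `g^{k̄ l} (Υ(g,g')_{li}^p Ω̃_{p k̄ A}^B + Υ_{lA}^C Ω̃_{i k̄ C}^B - Υ_{lC}^B Ω̃_{i k̄ A}^C)`,
where `Υ = Υ(h, h')`. -/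
def upsilonCurv {n : ℕ} {ι : Type} [Fintype ι] [DecidableEq ι]
    (g g' : Cn n → Matrix (Fin n) (Fin n) ℂ) (h h' : Cn n → Matrix ι ι ℂ)
    (i : Fin n) (A B : ι) (z : Cn n) : ℂ :=
  ∑ k, ∑ l, (g z)⁻¹ k l *
    (∑ p, upsilon g g' l i p z * chernCurv h' p k A B z
      + ∑ C, upsilon h h' l A C z * chernCurv h' i k C B z
      - ∑ C, upsilon h h' l C B z * chernCurv h' i k A C z)

/-- `g^{k̄ l} ∇̃_l Ω̃_{i k̄ A}^B`, where `∇̃` is the Chern connection of `g'` on the index `i` and of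
`h'` on `A`, `B`. -/
def gradCurv {n : ℕ} {ι : Type} [Fintype ι] [DecidableEq ι]
    (g g' : Cn n → Matrix (Fin n) (Fin n) ℂ) (h' : Cn n → Matrix ι ι ℂ)
    (i : Fin n) (A B : ι) (z : Cn n) : ℂ :=
  ∑ k, ∑ l, (g z)⁻¹ k l * nabla g' h' l (fun p C D w => chernCurv h' p k C D w) i A B z

/-- `2 Re ⟨Φ, Υ⟩` for a section `Φ_{iA}^B` and `Υ = Υ(h, h')`. -/
def twoRePairing {n : ℕ} {ι : Type} [Fintype ι] [DecidableEq ι]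
    (g : Cn n → Matrix (Fin n) (Fin n) ℂ) (h h' : Cn n → Matrix ι ι ℂ)
    (Φ : Fin n → ι → ι → Cn n → ℂ) (z : Cn n) : ℂ :=
  ((2 * (pairing (g z) (h z) (fun i A B => Φ i A B z)
    (fun i A B => upsilon h h' i A B z)).re : ℝ) : ℂ)

/-! ## Metrics and forms on complex manifolds, pluriclosed flow -/

section Manifold

variable (n : ℕ) (M : Type*) [TopologicalSpace M] [ChartedSpace (Cn n) M]

/-- The holomorphic charts of the complex manifold `M`. -/
abbrev holCharts : Set (OpenPartialHomeomorph M (Cn n)) :=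
  IsManifold.maximalAtlas 𝓘(ℂ, Cn n) ω M

variable {n M}

/-- The coordinate vector field `∂/∂z^i` of the chart `e`, at the point with coordinates `z`. The
complex vector space `TangentSpace 𝓘(ℂ, Cn n) x` is the holomorphic tangent space `T^{1,0}_x M`. -/
def coordVec (e : OpenPartialHomeomorph M (Cn n)) (z : Cn n) (i : Fin n) :
    TangentSpace 𝓘(ℂ, Cn n) (e.symm z) :=
  mfderiv 𝓘(ℂ, Cn n) 𝓘(ℂ, Cn n) e.symm z (Pi.single i (1 : ℂ) : Cn n)

variable (n M)

/-- A smooth Hermitian metric on `M`: `form x v w = g_x(v, w̄)`, linear in `v` and conjugate linear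
in `w`. -/
structure HermitianMetric where
  form : ∀ x : M, TangentSpace 𝓘(ℂ, Cn n) x →ₗ[ℂ] TangentSpace 𝓘(ℂ, Cn n) x →ₗ⋆[ℂ] ℂ
  symm : ∀ x v w, form x w v = conj (form x v w)
  pos : ∀ x v, v ≠ 0 → 0 < (form x v v).re
  smooth : ∀ e ∈ holCharts n M, ∀ i j, ContDiffOn ℝ ∞
    (fun z => form (e.symm z) (coordVec e z i) (coordVec e z j)) e.target

/-- A smooth `(2,0)`-form on `M`: `form x v w = β_x(v, w)`, complex bilinear and alternating on
`T^{1,0}_x M`. -/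
structure TwoZeroForm where
  form : ∀ x : M, TangentSpace 𝓘(ℂ, Cn n) x →ₗ[ℂ] TangentSpace 𝓘(ℂ, Cn n) x →ₗ[ℂ] ℂ
  alt : ∀ x v, form x v v = 0
  smooth : ∀ e ∈ holCharts n M, ∀ i j, ContDiffOn ℝ ∞
    (fun z => form (e.symm z) (coordVec e z i) (coordVec e z j)) e.target

variable {n M}

/-- The components `g_{i j̄}` in the chart `e`. -/
def HermitianMetric.comp (g : HermitianMetric n M) (e : OpenPartialHomeomorph M (Cn n))
    (z : Cn n) : Matrix (Fin n) (Fin n) ℂ :=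
  Matrix.of fun i j => g.form (e.symm z) (coordVec e z i) (coordVec e z j)

/-- The components `β_{ij} = β(∂_i, ∂_j)` in the chart `e`. -/
def TwoZeroForm.comp (b : TwoZeroForm n M) (e : OpenPartialHomeomorph M (Cn n))
    (z : Cn n) : Matrix (Fin n) (Fin n) ℂ :=
  Matrix.of fun i j => b.form (e.symm z) (coordVec e z i) (coordVec e z j)

/-- The components of the generalized metric `G(g, β)` in the chart `e`. -/
def genComp (g : HermitianMetric n M) (b : TwoZeroForm n M) (e : OpenPartialHomeomorph M (Cn n)) :
    Cn n → Matrix (GIdx n) (GIdx n) ℂ :=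
  genMetric (g.comp e) (b.comp e)

/-- `(g_t, β_t)`, `t ∈ J`, is a smooth solution of pluriclosed flow: `∂_t ω = -ρ_B^{1,1}` and
`∂_t β = -ρ_B^{2,0}`, where `β` is a torsion potential, `∂ω + ∂̄β = 0`. (The sign in the last
equation is the one that the flow preserves: `dρ_B = 0` gives `∂_t (∂ω + ∂̄β) = 0`.) -/
structure IsPluriclosedFlow (J : Set ℝ) (g : ℝ → HermitianMetric n M)
    (b : ℝ → TwoZeroForm n M) : Prop where
  smooth_metric : ∀ e ∈ holCharts n M, ∀ i j, ContDiffOn ℝ ∞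
    (fun p : ℝ × Cn n => (g p.1).comp e p.2 i j) (J ×ˢ e.target)
  smooth_potential : ∀ e ∈ holCharts n M, ∀ i j, ContDiffOn ℝ ∞
    (fun p : ℝ × Cn n => (b p.1).comp e p.2 i j) (J ×ˢ e.target)
  torsion_potential : ∀ e ∈ holCharts n M, ∀ t ∈ J, ∀ z ∈ e.target, ∀ i j k,
    dz i (fun w => fundForm ((g t).comp e) j k w) z - dz j (fun w => fundForm ((g t).comp e) i k w) z
      + dzbar k (fun w => (b t).comp e w i j) z = 0
  metric_evolution : ∀ e ∈ holCharts n M, ∀ t ∈ J, ∀ z ∈ e.target, ∀ i j,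
    HasDerivWithinAt (fun s => fundForm ((g s).comp e) i j z) (-rhoB11 ((g t).comp e) i j z) J t
  potential_evolution : ∀ e ∈ holCharts n M, ∀ t ∈ J, ∀ z ∈ e.target, ∀ i j,
    HasDerivWithinAt (fun s => (b s).comp e z i j) (-rhoB20 ((g t).comp e) i j z) J t

end Manifold

end PCF

end

open PCF

noncomputable section

namespace PCF

/-! ## Derivations of matrices -/

section MatrixDerivation

variable {R : Type*} [CommRing R] [Algebra ℂ R] (δ : Derivation ℂ R R)
variable {k m l : Type*}

/-! The formula rests on one structural fact: under pluriclosed flow the generalized metric evolves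
by its own contracted Chern curvature, `∂_t G = -g^{k̄ l} Ω_{l k̄}`, while `∂_t g = -S + Q`, where
`S` is the analogous contraction for `g` and `Q` is quadratic in the torsion (`genMat_evolution`,
`metric_evolution`). To see the first, write `G = P diag(g, g⁻ᵀ) P^*` with `P = (1, β; 0, 1)` and
compute the curvature block by block in the sheared frame (`genMat_curv`). As `∂̄β = -√-1 T`, the
term quadratic in `∂̄β` is exactly `Q`, the off-diagonal block is the equation `∂_t β = Δβ`, and the
skew symmetry of `β` matches the last block with the evolution of `g⁻ᵀ`.

After that the argument is a Bochner computation for any bundle metric `h` with `∂_t h = -g^{k̄ l}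
Ω_{l k̄}` (`evolution_tracePairing`). The variation of the Chern connection is the covariant
derivative of `∂_t h h⁻¹`; the second Bianchi identity turns it into a divergence of curvature plus
a torsion term (`dt_chernMat`). Hence `∂_t Υ = ΔΥ - T * ∇̄Υ + E`, with `E` built from the background
connection alone. In `(∂_t - Δ)|Υ|²` the contracted curvatures arising from commuting `∇` with `∇̄`
cancel those arising from `∂_t` of the metrics. What survives besides `-|∇Υ|² - |∇̄Υ|²` is the pair
of cross terms `T * ∇̄Υ * Ῡ` and the term `Q * Υ * Ῡ`; because contraction with `T` is adjoint to `Υ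
↦ T·Υ` (`tracePairing_torsMul`, `tors_torsMul`), these complete the square `-|∇̄Υ + T·Υ|²`. Finally
`E` is rewritten with background derivatives, the difference of connections producing the `Υ`-terms
(`error_decomposition`).

All of this is algebra of commuting derivations, carried out in an abstract star ring
(`WirtingerCalculus`). It is applied to the smooth functions on `J × U`, with `U` the target of a
chart, and evaluated at a point; derivatives within the set cover the end points of `J`. -/

theorem derivation_map_mul [Fintype m] (A : Matrix k m R) (B : Matrix m l R) :
    (A * B).map δ = A.map δ * B + A * B.map δ := by
  ext i j
  simp only [Matrix.map_apply, Matrix.mul_apply, Matrix.add_apply, map_sum, Derivation.leibniz,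
    smul_eq_mul, Finset.sum_add_distrib]
  rw [add_comm]
  congr 1
  exact Finset.sum_congr rfl fun x _ => mul_comm _ _

theorem derivation_map_add (A B : Matrix k l R) : (A + B).map δ = A.map δ + B.map δ :=
  Matrix.map_add _ (map_add δ) A B

theorem derivation_map_sub (A B : Matrix k l R) : (A - B).map δ = A.map δ - B.map δ :=
  Matrix.map_sub _ (map_sub δ) A B

theorem derivation_map_neg (A : Matrix k l R) : (-A).map δ = -A.map δ := by
  ext; simp

theorem derivation_map_one [DecidableEq k] : (1 : Matrix k k R).map δ = 0 := by
  ext i j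
  by_cases h : i = j
  · subst h; simp
  · simp [h]

theorem derivation_map_smul (f : R) (A : Matrix k l R) :
    (f • A).map δ = δ f • A + f • A.map δ := by
  ext
  simp only [Matrix.map_apply, Matrix.smul_apply, Matrix.add_apply, smul_eq_mul,
    Derivation.leibniz]
  ring

theorem derivation_map_sum {α : Type*} (s : Finset α) (F : α → Matrix k l R) :
    (∑ a ∈ s, F a).map δ = ∑ a ∈ s, (F a).map δ := by
  ext; simp [Matrix.sum_apply]

theorem derivation_trace [Fintype k] (A : Matrix k k R) : δ A.trace = (A.map δ).trace := by
  simp [Matrix.trace]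

theorem derivation_map_inv [Fintype k] [DecidableEq k] {A B : Matrix k k R} (h : A * B = 1) :
    B.map δ = -(B * A.map δ * B) := by
  have h' : B * A = 1 := mul_eq_one_comm.mp h
  have h1 := derivation_map_mul δ A B
  rw [h, derivation_map_one] at h1
  have h2 : A * B.map δ = -(A.map δ * B) := (neg_eq_of_add_eq_zero_right h1.symm).symm
  calc B.map δ = (B * A) * B.map δ := by rw [h', one_mul]
    _ = B * (A * B.map δ) := mul_assoc _ _ _
    _ = -(B * A.map δ * B) := by rw [h2, mul_neg, mul_assoc]

end MatrixDerivation

/-! ## Wirtinger calculus in a commutative star ring -/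

/-- Commuting derivations `∂_k`, `∂_{k̄}`, `∂_t` of a commutative star ring, compatible with
conjugation. The model is the ring of smooth functions of `(t, z)`. -/
structure WirtingerCalculus (n : ℕ) (R : Type*) [CommRing R] [StarRing R] [Algebra ℂ R] where
  d : Fin n → Derivation ℂ R R
  db : Fin n → Derivation ℂ R R
  dt : Derivation ℂ R R
  star_d : ∀ k f, star (d k f) = db k (star f)
  star_dt : ∀ f, star (dt f) = dt (star f)
  d_d : ∀ k l f, d k (d l f) = d l (d k f)
  d_db : ∀ k l f, d k (db l f) = db l (d k f)
  dt_d : ∀ k f, dt (d k f) = d k (dt f)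

/-! ### Hermitian pairing of endomorphism-valued (1,0)-forms and its product rule -/

section Pairing

variable {R : Type*} [CommRing R] {n : ℕ} {ι : Type} [Fintype ι]

/-- The pairing `g^{j̄ i} tr(h⁻¹ Φ_i h Ψ_j^*)` with `gi = g⁻¹` and `hi = h⁻¹`. -/
def tracePairing [StarRing R] (gi : Matrix (Fin n) (Fin n) R) (h hi : Matrix ι ι R)
    (Φ Ψ : Fin n → Matrix ι ι R) : R :=
  ∑ i, ∑ j, gi j i * (hi * Φ i * h * (Ψ j).conjTranspose).trace

/-- Covariant derivative along a derivation `δ` of a section `Φ_{iA}^B`, for connection matrices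
`a` on the index `i` and `c` on `A`, `B`. -/
def covDeriv [Algebra ℂ R] (δ : Derivation ℂ R R) (a : Matrix (Fin n) (Fin n) R)
    (c : Matrix ι ι R) (Φ : Fin n → Matrix ι ι R) (i : Fin n) : Matrix ι ι R :=
  (Φ i).map δ - ∑ p, a i p • Φ p - c * Φ i + Φ i * c

section Linear

variable [StarRing R] (gi : Matrix (Fin n) (Fin n) R) (h hi : Matrix ι ι R)

theorem tracePairing_add_left (Φ Φ' Ψ : Fin n → Matrix ι ι R) :
    tracePairing gi h hi (fun i => Φ i + Φ' i) Ψ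
      = tracePairing gi h hi Φ Ψ + tracePairing gi h hi Φ' Ψ := by
  simp only [tracePairing, mul_add, add_mul, Matrix.trace_add, Finset.sum_add_distrib]

theorem tracePairing_sub_left (Φ Φ' Ψ : Fin n → Matrix ι ι R) :
    tracePairing gi h hi (fun i => Φ i - Φ' i) Ψ
      = tracePairing gi h hi Φ Ψ - tracePairing gi h hi Φ' Ψ := by
  simp only [tracePairing, mul_sub, sub_mul, Matrix.trace_sub, Finset.sum_sub_distrib]

theorem tracePairing_smul_left (f : R) (Φ Ψ : Fin n → Matrix ι ι R) :
    tracePairing gi h hi (fun i => f • Φ i) Ψ = f * tracePairing gi h hi Φ Ψ := by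
  simp only [tracePairing, mul_smul_comm, smul_mul_assoc, Matrix.trace_smul, smul_eq_mul,
    Finset.mul_sum]
  exact Finset.sum_congr rfl fun i _ => Finset.sum_congr rfl fun j _ => mul_left_comm _ _ _

theorem tracePairing_sum_left {α : Type*} (s : Finset α) (Φ : α → Fin n → Matrix ι ι R)
    (Ψ : Fin n → Matrix ι ι R) :
    tracePairing gi h hi (fun i => ∑ a ∈ s, Φ a i) Ψ
      = ∑ a ∈ s, tracePairing gi h hi (Φ a) Ψ := by
  classical
  induction s using Finset.induction_on with
  | empty => simp [tracePairing]
  | insert a s ha ih =>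
    simp only [Finset.sum_insert ha, tracePairing_add_left, ih]

variable {gi h hi}

theorem star_tracePairing (hg : gi.IsHermitian) (hh : h.IsHermitian) (hhi : hi.IsHermitian)
    (Φ Ψ : Fin n → Matrix ι ι R) :
    star (tracePairing gi h hi Φ Ψ) = tracePairing gi h hi Ψ Φ := by
  simp only [tracePairing, star_sum, star_mul', ← Matrix.trace_conjTranspose,
    Matrix.conjTranspose_mul, Matrix.conjTranspose_conjTranspose, hh.eq, hhi.eq]
  rw [Finset.sum_comm]
  refine Finset.sum_congr rfl fun j _ => Finset.sum_congr rfl fun i _ => ?_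
  rw [hg.apply]
  congr 1
  rw [← mul_assoc, ← mul_assoc, Matrix.trace_mul_comm]
  simp only [mul_assoc]

theorem tracePairing_add_right (hg : gi.IsHermitian) (hh : h.IsHermitian) (hhi : hi.IsHermitian)
    (Φ Ψ Ψ' : Fin n → Matrix ι ι R) :
    tracePairing gi h hi Φ (fun i => Ψ i + Ψ' i)
      = tracePairing gi h hi Φ Ψ + tracePairing gi h hi Φ Ψ' := by
  rw [← star_tracePairing hg hh hhi, tracePairing_add_left, star_add,
    star_tracePairing hg hh hhi, star_tracePairing hg hh hhi]

end Linear

/-- Differentiating `g⁻¹`, `h⁻¹` and `h` gives terms in `δg g⁻¹` and `δh h⁻¹`, all of which can be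
absorbed into the first slot. For `δ = ∂_l` this is compatibility of the Chern connection with the
metrics; for `δ = ∂_t` the same identity records the variation of the norm, so one lemma serves
both. -/
theorem derivation_tracePairing [StarRing R] [Algebra ℂ R] [DecidableEq ι]
    (δ δ' : Derivation ℂ R R) (hδ : ∀ f, δ (star f) = star (δ' f))
    {g gi : Matrix (Fin n) (Fin n) R} {h hi : Matrix ι ι R}
    (hg : g * gi = 1) (hh : h * hi = 1) (Φ Ψ : Fin n → Matrix ι ι R) :
    δ (tracePairing gi h hi Φ Ψ)
      = tracePairing gi h hi (covDeriv δ (g.map δ * gi) (h.map δ * hi) Φ) Ψ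
        + tracePairing gi h hi Φ (fun j => (Ψ j).map δ') := by
  have hstar : ∀ A : Matrix ι ι R, A.conjTranspose.map δ = (A.map δ').conjTranspose := by
    intro A; ext; simp [hδ]
  have h' : hi * h = 1 := mul_eq_one_comm.mp hh
  have e1 : tracePairing gi h hi (fun i => ∑ p, (g.map δ * gi) i p • Φ p) Ψ
      = -∑ i, ∑ j, δ (gi j i) * (hi * Φ i * h * (Ψ j).conjTranspose).trace := by
    rw [tracePairing_sum_left gi h hi Finset.univ (fun p i => (g.map δ * gi) i p • Φ p)]
    rw [← Finset.sum_neg_distrib]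
    refine Finset.sum_congr rfl fun p _ => ?_
    simp only [tracePairing, mul_smul_comm, smul_mul_assoc, Matrix.trace_smul, smul_eq_mul]
    rw [Finset.sum_comm, ← Finset.sum_neg_distrib]
    refine Finset.sum_congr rfl fun j _ => ?_
    have e : δ (gi j p) = -∑ i, gi j i * (g.map δ * gi) i p := by
      have := congrFun (congrFun (derivation_map_inv δ hg) j) p
      rw [Matrix.map_apply, mul_assoc, Matrix.neg_apply, Matrix.mul_apply] at this
      exact this
    rw [e, neg_mul, neg_neg, Finset.sum_mul]
    exact Finset.sum_congr rfl fun i _ => (mul_assoc _ _ _).symm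
  have e2 : ∀ i, hi * covDeriv δ (g.map δ * gi) (h.map δ * hi) Φ i * h
      = (hi * Φ i * h).map δ - hi * (∑ p, (g.map δ * gi) i p • Φ p) * h := by
    intro i
    rw [derivation_map_mul, derivation_map_mul, derivation_map_inv δ hh]
    simp only [covDeriv, mul_add, mul_sub, add_mul, sub_mul, neg_mul]
    have e3 : hi * (Φ i * (h.map δ * hi)) * h = hi * Φ i * h.map δ := by
      simp only [mul_assoc, h', mul_one]
    rw [e3]
    simp only [mul_assoc]
    abel
  have e4 : tracePairing gi h hi (covDeriv δ (g.map δ * gi) (h.map δ * hi) Φ) Ψ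
      = ∑ i, ∑ j, gi j i * ((hi * Φ i * h).map δ * (Ψ j).conjTranspose).trace
        - tracePairing gi h hi (fun i => ∑ p, (g.map δ * gi) i p • Φ p) Ψ := by
    simp only [tracePairing, e2, sub_mul, Matrix.trace_sub, mul_sub, Finset.sum_sub_distrib]
  rw [e4, e1, sub_neg_eq_add]
  simp only [tracePairing, map_sum, Derivation.leibniz, derivation_trace,
    derivation_map_mul δ (_ * _ * _), hstar, smul_eq_mul, Matrix.trace_add, mul_add, Finset.sum_add_distrib, mul_comm (δ _)]
  simp only [mul_comm _ (δ _)]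
  ring

end Pairing

namespace WirtingerCalculus

variable {R : Type*} [CommRing R] [StarRing R] [Algebra ℂ R] {n : ℕ}
  (W : WirtingerCalculus n R)

theorem star_db (k : Fin n) (f : R) : star (W.db k f) = W.d k (star f) := by
  rw [← star_star (W.d k (star f)), W.star_d, star_star]

theorem db_db (k l : Fin n) (f : R) : W.db k (W.db l f) = W.db l (W.db k f) := by
  apply star_injective
  rw [star_db, star_db, star_db, star_db, W.d_d]

section Matrices

variable {α β : Type*} (A : Matrix α β R)

theorem map_d_d (k l : Fin n) : (A.map (W.d l)).map (W.d k) = (A.map (W.d k)).map (W.d l) := by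
  ext; simp [W.d_d k l]

theorem map_d_db (k l : Fin n) : (A.map (W.db l)).map (W.d k) = (A.map (W.d k)).map (W.db l) := by
  ext; simp [W.d_db k l]

theorem map_dt_d (k : Fin n) : (A.map (W.d k)).map W.dt = (A.map W.dt).map (W.d k) := by
  ext; simp [W.dt_d k]

theorem conjTranspose_map_d (k : Fin n) :
    (A.map (W.d k)).conjTranspose = A.conjTranspose.map (W.db k) := by
  ext; simp [W.star_d]

end Matrices

/-! ### Chern connection, curvature and torsion over the ring -/

variable {ι : Type} [Fintype ι] [DecidableEq ι]

/-- The Chern connection matrix `(∂_l h) h⁻¹`, with `hi = h⁻¹`. -/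
def chernMat (h hi : Matrix ι ι R) (l : Fin n) : Matrix ι ι R := h.map (W.d l) * hi

/-- The Chern curvature `Ω_{i k̄} = -∂_{k̄} Γ_i`, with `hi = h⁻¹`. -/
def curvMat (h hi : Matrix ι ι R) (k i : Fin n) : Matrix ι ι R :=
  -(W.chernMat h hi i).map (W.db k)

/-- The Chern covariant derivative `∇_l Φ` of a section `Φ_{iA}^B`. -/
def cov (g gi : Matrix (Fin n) (Fin n) R) (h hi : Matrix ι ι R) (l : Fin n)
    (Φ : Fin n → Matrix ι ι R) : Fin n → Matrix ι ι R :=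
  covDeriv (W.d l) (W.chernMat g gi l) (W.chernMat h hi l) Φ

/-- Torsion `T_{ij}^k` of the Chern connection. -/
def tors (g gi : Matrix (Fin n) (Fin n) R) (i j k : Fin n) : R :=
  W.chernMat g gi i j k - W.chernMat g gi j i k

/-- Torsion `T_{ij k̄} = ∂_i g_{j k̄} - ∂_j g_{i k̄}`. -/
def torsLow (g : Matrix (Fin n) (Fin n) R) (i j k : Fin n) : R :=
  W.d i (g j k) - W.d j (g i k)

/-- `(T·Φ)_{k̄ i} = g^{q̄ p} conj(T_{qk ī}) Φ_p`. -/
def torsMul (g gi : Matrix (Fin n) (Fin n) R) (Φ : Fin n → Matrix ι ι R) (k i : Fin n) :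
    Matrix ι ι R :=
  ∑ p, ∑ q, (gi q p * star (W.torsLow g q k i)) • Φ p

/-- `g^{k̄ l} (∂_l ∂_{k̄} h - (∂_l h) h⁻¹ ∂_{k̄} h)`, the contraction `-g^{k̄ l} Ω_{l k̄}` of the
Chern curvature of `h` with its last index lowered. -/
def curvTrace (gi : Matrix (Fin n) (Fin n) R) (h hi : Matrix ι ι R) : Matrix ι ι R :=
  ∑ k, ∑ l, gi k l •
    ((h.map (W.d l)).map (W.db k) - h.map (W.d l) * hi * h.map (W.db k))

/-- `Q_{i j̄} = g^{k̄ l} g^{q̄ p} T_{ip k̄} conj(T_{jq l̄})`. -/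
def torsSq (g gi : Matrix (Fin n) (Fin n) R) : Matrix (Fin n) (Fin n) R :=
  Matrix.of fun i j => ∑ k, ∑ l, ∑ q, ∑ p,
    gi k l * gi q p * (W.torsLow g i p k * star (W.torsLow g j q l))

/-! ### The torsion acting on sections, and its adjoint -/

section Torsion

variable {g gi : Matrix (Fin n) (Fin n) R}

omit [StarRing R] [Algebra ℂ R] in
theorem sum_perm_six (F : Fin n → Fin n → Fin n → Fin n → Fin n → Fin n → R) :
    ∑ k, ∑ l, ∑ p, ∑ r, ∑ q, ∑ m, F k l p r q m = ∑ r, ∑ q, ∑ m, ∑ p, ∑ k, ∑ l, F k l p r q m :=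
  calc _ = ∑ x : Fin n × Fin n × Fin n × Fin n × Fin n × Fin n,
        F x.1 x.2.1 x.2.2.1 x.2.2.2.1 x.2.2.2.2.1 x.2.2.2.2.2 := by
        simp only [Fintype.sum_prod_type]
    _ = ∑ y : Fin n × Fin n × Fin n × Fin n × Fin n × Fin n,
        F y.2.2.2.2.1 y.2.2.2.2.2 y.2.2.2.1 y.1 y.2.1 y.2.2.1 :=
        Fintype.sum_equiv
          ⟨fun x => (x.2.2.2.1, x.2.2.2.2.1, x.2.2.2.2.2, x.2.2.1, x.1, x.2.1),
            fun y => (y.2.2.2.2.1, y.2.2.2.2.2, y.2.2.2.1, y.1, y.2.1, y.2.2.1),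
            fun _ => rfl, fun _ => rfl⟩ _ _ fun _ => rfl
    _ = _ := by simp only [Fintype.sum_prod_type]

/-- Since `Γ_l g = ∂_l g`, lowering the index removes the inverse metric; this links the lowered
torsion given by derivatives alone to the contraction with `g`. -/
theorem tors_mul (hg : g * gi = 1) (i j k : Fin n) :
    ∑ p, W.tors g gi i j p * g p k = W.torsLow g i j k := by
  have h : ∀ l, W.chernMat g gi l * g = g.map (W.d l) := fun l => by
    rw [chernMat, mul_assoc, mul_eq_one_comm.mp hg, mul_one]
  have h1 : ∀ l j, ∑ p, W.chernMat g gi l j p * g p k = W.d l (g j k) := fun l j => by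
    rw [← Matrix.mul_apply, h, Matrix.map_apply]
  simp only [tors, sub_mul, Finset.sum_sub_distrib, h1, torsLow]

theorem torsLow_mul (i j k : Fin n) :
    ∑ p, W.torsLow g i j p * gi p k = W.tors g gi i j k := by
  simp only [tors, chernMat, torsLow, sub_mul, Finset.sum_sub_distrib, Matrix.mul_apply,
    Matrix.map_apply]

/-- Adjointness of the two actions of the torsion. -/
theorem tracePairing_torsMul (hgi : gi.IsHermitian) {h hi : Matrix ι ι R}
    (Φ : Fin n → Fin n → Matrix ι ι R) (Ψ : Fin n → Matrix ι ι R) :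
    ∑ k, ∑ m, gi k m * tracePairing gi h hi (Φ k) (W.torsMul g gi Ψ m)
      = tracePairing gi h hi
          (fun i => ∑ k, ∑ l, gi k l • ∑ p, W.tors g gi i l p • Φ k p) Ψ := by
  have e1 : ∀ k m, tracePairing gi h hi (Φ k) (W.torsMul g gi Ψ m)
      = ∑ i, ∑ p, ∑ q, W.tors g gi q m i * gi p q *
          (hi * Φ k i * h * (Ψ p).conjTranspose).trace := by
    intro k m
    simp only [tracePairing, torsMul, Matrix.conjTranspose_sum, Matrix.conjTranspose_smul,
      star_mul', star_star, Finset.mul_sum, Matrix.trace_sum, mul_smul_comm, Matrix.trace_smul,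
      smul_eq_mul, hgi.apply]
    refine Finset.sum_congr rfl fun i _ => ?_
    rw [Finset.sum_comm]
    refine Finset.sum_congr rfl fun p _ => ?_
    rw [Finset.sum_comm]
    refine Finset.sum_congr rfl fun q _ => ?_
    -- The conjugation in the second slot undoes the one in `T·Ψ`, and the factor of `g⁻¹` from the
    -- pairing raises the last index of the lowered torsion.
    rw [← torsLow_mul, Finset.sum_mul, Finset.sum_mul]
    exact Finset.sum_congr rfl fun j _ => by ring
  simp only [e1]
  rw [tracePairing_sum_left gi h hi Finset.univ]
  refine Finset.sum_congr rfl fun k _ => ?_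
  rw [tracePairing_sum_left gi h hi Finset.univ]
  refine Finset.sum_congr rfl fun m _ => ?_
  rw [tracePairing_smul_left]
  congr 1
  simp only [tracePairing, Finset.mul_sum, Finset.sum_mul, Matrix.trace_sum, mul_smul_comm,
    smul_mul_assoc, Matrix.trace_smul, smul_eq_mul]
  have e2 : ∀ F : Fin n → Fin n → Fin n → R,
      ∑ i, ∑ p, ∑ q, F i p q = ∑ q, ∑ p, ∑ i, F i p q := by
    intro F
    rw [Finset.sum_comm]
    rw [Finset.sum_congr rfl fun p _ => Finset.sum_comm, Finset.sum_comm]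
  rw [e2]
  exact Finset.sum_congr rfl fun q _ => Finset.sum_congr rfl fun p _ =>
    Finset.sum_congr rfl fun i _ => by ring

omit [Fintype ι] [DecidableEq ι] in
/-- `T * (T·Φ) = Q Φ`. -/
theorem tors_torsMul (Φ : Fin n → Matrix ι ι R)
    (i : Fin n) :
    ∑ k, ∑ l, gi k l • ∑ p, W.tors g gi i l p • W.torsMul g gi Φ k p
      = ∑ r, (W.torsSq g gi * gi) i r • Φ r := by
  ext A B
  simp only [torsMul, ← torsLow_mul, torsSq, Matrix.mul_apply, Matrix.of_apply, Matrix.sum_apply,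
    Matrix.smul_apply, smul_eq_mul, Finset.mul_sum, Finset.sum_mul]
  rw [sum_perm_six]
  refine Finset.sum_congr rfl fun r _ => Finset.sum_congr rfl fun q _ => Finset.sum_congr rfl
    fun m _ => Finset.sum_congr rfl fun p _ => Finset.sum_congr rfl fun k _ =>
    Finset.sum_congr rfl fun l _ => by ring

end Torsion

/-! ### Bianchi identity, commutators and variation of the Chern connection -/

section Curvature

variable {g gi : Matrix (Fin n) (Fin n) R} {h hi : Matrix ι ι R}

theorem map_db_chernMat (hh : h * hi = 1) (k l : Fin n) :
    (W.chernMat h hi l).map (W.db k)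
      = ((h.map (W.d l)).map (W.db k) - h.map (W.d l) * hi * h.map (W.db k)) * hi := by
  rw [chernMat, derivation_map_mul, derivation_map_inv _ hh]
  simp only [mul_neg, sub_mul, mul_assoc, ← sub_eq_add_neg]

/-- Along the flow the left side is `∂_t h h⁻¹`; this expresses it through `∂_{k̄} Γ_l`, the form to
which the Bianchi identity applies. -/
theorem curvTrace_mul (hh : h * hi = 1) :
    W.curvTrace gi h hi * hi = ∑ k, ∑ l, gi k l • (W.chernMat h hi l).map (W.db k) := by
  simp only [curvTrace, Finset.sum_mul, smul_mul_assoc, W.map_db_chernMat hh]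

/-- The curvature of a Chern connection has no (2,0) part: the derivative of `h⁻¹` cancels the
product of connection matrices, leaving `(∂_l ∂_i h) h⁻¹`, which is symmetric in `i` and `l`. -/
theorem chernMat_flat (hh : h * hi = 1) (i l : Fin n) :
    (W.chernMat h hi i).map (W.d l) + W.chernMat h hi i * W.chernMat h hi l
      = (W.chernMat h hi l).map (W.d i) + W.chernMat h hi l * W.chernMat h hi i := by
  simp only [chernMat, derivation_map_mul, derivation_map_inv _ hh, W.map_d_d h l i, mul_neg,
    mul_assoc, neg_add_cancel_right]

/-- The second Bianchi identity for the Chern curvature `Ω_{i k̄} = -∂_{k̄} Γ_i`. -/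
theorem bianchi (hh : h * hi = 1) (g gi : Matrix (Fin n) (Fin n) R) (i l k : Fin n) :
    W.cov g gi h hi i (fun p => (W.chernMat h hi p).map (W.db k)) l
      = W.cov g gi h hi l (fun p => (W.chernMat h hi p).map (W.db k)) i
        + ∑ p, W.tors g gi l i p • (W.chernMat h hi p).map (W.db k) := by
  -- The Bianchi identity is the `∂_{k̄}`-derivative of the vanishing of the (2,0) curvature. The
  -- torsion enters only because `g` also differentiates the form index.
  have e := congrArg (fun A => Matrix.map A (W.db k)) (W.chernMat_flat hh i l)
  simp only [derivation_map_add, derivation_map_mul, ← W.map_d_db] at e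
  simp only [cov, covDeriv, tors, sub_smul, Finset.sum_sub_distrib]
  linear_combination (norm := abel) -e

omit [DecidableEq ι] in
-- The commutator of `∇̄` and `∇`: as `∂_{k̄}` and `∂_l` commute, it consists of the terms where
-- `∂_{k̄}` hits the connection matrices.
theorem map_db_cov (Φ : Fin n → Matrix ι ι R) (k l i : Fin n) :
    (W.cov g gi h hi l Φ i).map (W.db k)
      = W.cov g gi h hi l (fun p => (Φ p).map (W.db k)) i
        - ∑ p, (W.chernMat g gi l).map (W.db k) i p • Φ p
        - (W.chernMat h hi l).map (W.db k) * Φ i + Φ i * (W.chernMat h hi l).map (W.db k) := by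
  simp only [cov, covDeriv, derivation_map_add, derivation_map_sub, derivation_map_mul,
    derivation_map_sum, derivation_map_smul, Finset.sum_add_distrib, ← W.map_d_db,
    Matrix.map_apply]
  abel

/-- Variation of the Chern connection when `∂_t h = -g^{k̄ l} Ω_{l k̄}`. -/
theorem dt_chernMat (hg : g * gi = 1) (hh : h * hi = 1) (hflow : h.map W.dt = W.curvTrace gi h hi)
    (i : Fin n) :
    (W.chernMat h hi i).map W.dt = ∑ k, ∑ l, gi k l •
      (W.cov g gi h hi l (fun p => (W.chernMat h hi p).map (W.db k)) i
        + ∑ p, W.tors g gi l i p • (W.chernMat h hi p).map (W.db k)) := by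
  have hh' : hi * h = 1 := mul_eq_one_comm.mp hh
  obtain ⟨K, hK⟩ : ∃ K, K = W.curvTrace gi h hi * hi := ⟨_, rfl⟩
  have hKh : h.map W.dt = K * h := by rw [hK, hflow, mul_assoc, hh', mul_one]
  -- With `K = ∂_t h h⁻¹`, the variation of the connection is the covariant derivative of the
  -- endomorphism `K`.
  have e1 : (W.chernMat h hi i).map W.dt
      = K.map (W.d i) + K * W.chernMat h hi i - W.chernMat h hi i * K := by
    rw [chernMat, derivation_map_mul, map_dt_d, derivation_map_inv _ hh, hKh, derivation_map_mul]
    simp only [add_mul, mul_neg, mul_assoc, hh, mul_one, sub_eq_add_neg]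
  -- This is `∇g⁻¹ = 0`: the derivative of `g⁻¹` supplies the connection term on the form index, so
  -- the contraction passes through `∇_i`.
  have e2 : ∀ k, ∑ l, W.d i (gi k l) • (W.chernMat h hi l).map (W.db k)
      = -∑ l, gi k l • ∑ p, W.chernMat g gi i l p • (W.chernMat h hi p).map (W.db k) := by
    intro k
    have e : ∀ p, W.d i (gi k p) = -∑ l, gi k l * W.chernMat g gi i l p := by
      intro p
      have := congrFun (congrFun (derivation_map_inv (W.d i) hg) k) p
      rwa [Matrix.map_apply, mul_assoc, Matrix.neg_apply, Matrix.mul_apply] at this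
    simp only [e, neg_smul, Finset.sum_neg_distrib, Finset.sum_smul, Finset.smul_sum, smul_smul]
    rw [Finset.sum_comm]
  rw [e1, hK, W.curvTrace_mul hh]
  simp only [← W.bianchi hh]
  simp only [derivation_map_sum, derivation_map_smul, Finset.sum_add_distrib, e2,
    cov, covDeriv, smul_add, smul_sub, Finset.sum_sub_distrib, Finset.sum_mul, Finset.mul_sum,
    smul_mul_assoc, mul_smul_comm, Finset.sum_neg_distrib]
  abel

end Curvature

/-- The evolution of `|Υ|²` for the difference `Υ` of the Chern connection of `h` and a stationary
connection `Γ'`, when `∂_t h = -g^{k̄ l} Ω_{l k̄}` and `∂_t g = -S + Q`. -/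
theorem evolution_tracePairing {g gi : Matrix (Fin n) (Fin n) R} {h hi : Matrix ι ι R}
    (hg : g * gi = 1) (hh : h * hi = 1) (hgi : gi.IsHermitian) (hhH : h.IsHermitian)
    (hhi : hi.IsHermitian)
    (hflow : h.map W.dt = W.curvTrace gi h hi)
    (gflow : g.map W.dt = W.curvTrace gi g gi + W.torsSq g gi)
    (Γ' : Fin n → Matrix ι ι R) (hΓ' : ∀ i, (Γ' i).map W.dt = 0) (Υ E : Fin n → Matrix ι ι R)
    (hΥ : ∀ i, Υ i = W.chernMat h hi i - Γ' i)
    (hE : ∀ i, E i = ∑ k, ∑ l, gi k l • (W.cov g gi h hi l (fun p => (Γ' p).map (W.db k)) i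
      + ∑ p, W.tors g gi l i p • (Γ' p).map (W.db k))) :
    W.dt (tracePairing gi h hi Υ Υ)
      = ∑ k, ∑ l, gi k l * W.d l (W.db k (tracePairing gi h hi Υ Υ))
        - ∑ l, ∑ m, gi m l *
            tracePairing gi h hi (W.cov g gi h hi l Υ) (W.cov g gi h hi m Υ)
        - ∑ k, ∑ m, gi k m * tracePairing gi h hi
            (fun i => (Υ i).map (W.db k) + W.torsMul g gi Υ k i)
            (fun i => (Υ i).map (W.db m) + W.torsMul g gi Υ m i)
        + (tracePairing gi h hi E Υ + star (tracePairing gi h hi E Υ)) := by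
  have sP := star_tracePairing (n := n) hgi hhH hhi
  have dP : ∀ l Φ Ψ, W.d l (tracePairing gi h hi Φ Ψ)
      = tracePairing gi h hi (W.cov g gi h hi l Φ) Ψ
        + tracePairing gi h hi Φ (fun j => (Ψ j).map (W.db l)) := fun l Φ Ψ =>
    derivation_tracePairing _ _ (fun f => (W.star_db l f).symm) hg hh Φ Ψ
  have dbP : ∀ l Φ Ψ, W.db l (tracePairing gi h hi Φ Ψ)
      = tracePairing gi h hi (fun j => (Φ j).map (W.db l)) Ψ
        + tracePairing gi h hi Φ (W.cov g gi h hi l Ψ) := by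
    intro l Φ Ψ
    rw [← sP Ψ Φ, ← W.star_d, dP, star_add, sP, sP, add_comm]
  -- `X = ∇̄Υ`, `L = ΔΥ`, `M` is `∇̄Υ` contracted with torsion, `N` is `Q` acting on `Υ`, and `S` is
  -- the action on `Υ` of both contracted curvatures.
  obtain ⟨X, hX⟩ : ∃ X : Fin n → Fin n → Matrix ι ι R, ∀ k i, X k i = (Υ i).map (W.db k) :=
    ⟨_, fun _ _ => rfl⟩
  obtain ⟨L, hL⟩ : ∃ L : Fin n → Matrix ι ι R,
    ∀ i, L i = ∑ k, ∑ l, gi k l • W.cov g gi h hi l (X k) i := ⟨_, fun _ => rfl⟩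
  obtain ⟨M, hM⟩ : ∃ M : Fin n → Matrix ι ι R,
    ∀ i, M i = ∑ k, ∑ l, gi k l • ∑ p, W.tors g gi i l p • X k p := ⟨_, fun _ => rfl⟩
  obtain ⟨N, hN⟩ : ∃ N : Fin n → Matrix ι ι R,
    ∀ i, N i = ∑ r, (W.torsSq g gi * gi) i r • Υ r := ⟨_, fun _ => rfl⟩
  obtain ⟨S, hS⟩ : ∃ S : Fin n → Matrix ι ι R,
    ∀ i, S i = ∑ p, (W.curvTrace gi g gi * gi) i p • Υ p
      + W.curvTrace gi h hi * hi * Υ i - Υ i * (W.curvTrace gi h hi * hi) := ⟨_, fun _ => rfl⟩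
  have hXf : ∀ k, (fun i => (Υ i).map (W.db k)) = X k := fun k => funext fun i => (hX k i).symm
  have dtΥ : ∀ i, (Υ i).map W.dt = L i + E i - M i := by
    intro i
    have e1 : (Υ i).map W.dt = (W.chernMat h hi i).map W.dt := by
      rw [hΥ, derivation_map_sub, hΓ', sub_zero]
    have e2 : ∀ k p, (W.chernMat h hi p).map (W.db k) = X k p + (Γ' p).map (W.db k) := by
      intro k p
      rw [hX, hΥ, derivation_map_sub, sub_add_cancel]
    rw [e1, W.dt_chernMat hg hh hflow, hL, hE, hM]
    have e3 : ∀ i l p, W.tors g gi i l p = -W.tors g gi l i p := fun i l p => (neg_sub _ _).symm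
    simp only [e2, e3 i, cov, covDeriv, derivation_map_add, smul_add, smul_sub, mul_add, add_mul,
      Finset.sum_add_distrib, Finset.sum_sub_distrib, Finset.sum_neg_distrib, neg_smul, smul_neg]
    abel
  -- The product rule along `∂_t` puts the variation of both metrics into one slot; the flow
  -- equations identify it as `-N - S`.
  have dtP : W.dt (tracePairing gi h hi Υ Υ)
      = tracePairing gi h hi (fun i => (Υ i).map W.dt) Υ
        + star (tracePairing gi h hi (fun i => (Υ i).map W.dt - N i - S i) Υ) := by
    have e := derivation_tracePairing W.dt W.dt (fun f => (W.star_dt f).symm) hg hh Υ Υ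
    have e1 : covDeriv W.dt (g.map W.dt * gi) (h.map W.dt * hi) Υ
        = fun i => (Υ i).map W.dt - N i - S i := by
      funext i
      rw [hN, hS, covDeriv, gflow, hflow]
      simp only [add_mul, Matrix.add_apply, add_smul, Finset.sum_add_distrib]
      abel
    have e2 := congrArg star e
    rw [W.star_dt, sP, star_add, sP, e1] at e2
    rw [e2, ← sP Υ, add_comm, sP, sP]
  have lapP : ∀ k l, W.d l (W.db k (tracePairing gi h hi Υ Υ))
      = tracePairing gi h hi (W.cov g gi h hi l (X k)) Υ
        + tracePairing gi h hi (X k) (X l)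
        + tracePairing gi h hi (W.cov g gi h hi l Υ) (W.cov g gi h hi k Υ)
        + star (tracePairing gi h hi (fun i => (W.cov g gi h hi k Υ i).map (W.db l)) Υ) := by
    intro k l
    rw [dbP, map_add, dP, dP, hXf, hXf, sP]
    ring
  -- Contracting the commutator of `∇̄` and `∇` gives `-S`, the same curvature action that the flow
  -- produces, so it drops out of the difference.
  have comm : ∑ k, ∑ l, gi k l *
        star (tracePairing gi h hi (fun i => (W.cov g gi h hi k Υ i).map (W.db l)) Υ)
      = star (tracePairing gi h hi (fun i => L i - S i) Υ) := by
    have e : (fun i => L i - S i)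
        = fun i => ∑ l, ∑ k, gi l k • (W.cov g gi h hi k Υ i).map (W.db l) := by
      funext i
      rw [hL, hS, W.curvTrace_mul hg, W.curvTrace_mul hh]
      simp only [W.map_db_cov, hXf, smul_add, smul_sub, Finset.sum_add_distrib,
        Finset.sum_sub_distrib, Finset.sum_mul, Finset.mul_sum, smul_mul_assoc, mul_smul_comm,
        Matrix.sum_apply, Matrix.smul_apply, Finset.sum_smul, Finset.smul_sum, smul_smul,
        smul_eq_mul]
      have e1 : ∀ F : Fin n → Fin n → Fin n → Matrix ι ι R,
          ∑ p, ∑ k, ∑ l, F p k l = ∑ k, ∑ l, ∑ p, F p k l := by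
        intro F
        rw [Finset.sum_comm]
        exact Finset.sum_congr rfl fun k _ => Finset.sum_comm
      rw [e1]
      abel
    rw [e, tracePairing_sum_left gi h hi Finset.univ, star_sum, Finset.sum_comm]
    refine Finset.sum_congr rfl fun l _ => ?_
    rw [tracePairing_sum_left gi h hi Finset.univ, star_sum]
    refine Finset.sum_congr rfl fun k _ => ?_
    rw [tracePairing_smul_left, star_mul', hgi.apply]
  have lapL : ∑ k, ∑ l, gi k l * tracePairing gi h hi (W.cov g gi h hi l (X k)) Υ
      = tracePairing gi h hi L Υ := by
    rw [funext hL, tracePairing_sum_left gi h hi Finset.univ]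
    refine Finset.sum_congr rfl fun k _ => ?_
    rw [tracePairing_sum_left gi h hi Finset.univ]
    exact Finset.sum_congr rfl fun l _ => (tracePairing_smul_left _ _ _ _ _ _).symm
  -- By adjointness the cross terms of `|∇̄Υ + T·Υ|²` are `⟨M, Υ⟩` and its conjugate, and `|T·Υ|²`
  -- is `⟨N, Υ⟩`.
  have cross := W.tracePairing_torsMul hgi (g := g) (h := h) (hi := hi) X Υ
  rw [← funext hM] at cross
  have cross' : ∑ k, ∑ m, gi k m * tracePairing gi h hi (W.torsMul g gi Υ k) (X m)
      = star (tracePairing gi h hi M Υ) := by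
    rw [← cross, Finset.sum_comm, star_sum]
    refine Finset.sum_congr rfl fun m _ => ?_
    rw [star_sum]
    refine Finset.sum_congr rfl fun k _ => ?_
    rw [star_mul', hgi.apply, sP]
  have square := W.tracePairing_torsMul hgi (g := g) (h := h) (hi := hi) (W.torsMul g gi Υ) Υ
  rw [funext (W.tors_torsMul Υ), ← funext hN] at square
  -- Reality is needed because `N` enters the time derivative only through the conjugated slot.
  have square' : tracePairing gi h hi N Υ = star (tracePairing gi h hi N Υ) := by
    rw [← square, star_sum, Finset.sum_comm]
    refine Finset.sum_congr rfl fun m _ => ?_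
    rw [star_sum]
    refine Finset.sum_congr rfl fun k _ => ?_
    rw [star_mul', hgi.apply, sP]
  have eC : ∑ l, ∑ m, gi m l *
        tracePairing gi h hi (W.cov g gi h hi l Υ) (W.cov g gi h hi m Υ)
      = ∑ k, ∑ l, gi k l *
        tracePairing gi h hi (W.cov g gi h hi l Υ) (W.cov g gi h hi k Υ) := Finset.sum_comm
  rw [dtP, eC]
  simp only [lapP, ← hX, dtΥ, tracePairing_add_left, tracePairing_sub_left,
    tracePairing_add_right hgi hhH hhi, mul_add, Finset.sum_add_distrib, star_add, star_sub, comm,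
    lapL, cross, cross', square]
  rw [← square']
  ring

end WirtingerCalculus

/-! ### Pluriclosed flow and the generalized metric over the ring -/

namespace WirtingerCalculus

variable {R : Type*} [CommRing R] [StarRing R] [Algebra ℂ R] {n : ℕ}
  (W : WirtingerCalculus n R)

/-- The equations of pluriclosed flow for `g` and `β` in the ring of smooth functions. The
commutator terms of the curvature of the Bismut connection have vanishing trace. -/
structure IsFlow (g gi B : Matrix (Fin n) (Fin n) R) : Prop where
  mul_inv : g * gi = 1
  isHermitian : g.IsHermitian
  alt : B.transpose = -B
  potential : ∀ i j k, W.db k (B i j) = -(Complex.I • W.torsLow g i j k)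
  dt_metric : ∀ i j, W.dt (g i j) = -∑ a, (
    W.d i (∑ l, (W.db j (g a l) - W.db l (g a j)) * gi l a) -
    W.db j (∑ l, W.d a (g i l) * gi l a))
  dt_potential : ∀ i j, W.dt (B i j) = -(Complex.I • ∑ a, (
    W.d i (∑ l, W.d a (g j l) * gi l a) - W.d j (∑ l, W.d a (g i l) * gi l a)))

/-- The generalized metric of `g` and `β`. -/
def genMat (g gi B : Matrix (Fin n) (Fin n) R) : Matrix (GIdx n) (GIdx n) R :=
  Matrix.fromBlocks (g + B * gi.transpose * B.conjTranspose) (B * gi.transpose)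
    (gi.transpose * B.conjTranspose) gi.transpose

/-- The inverse of the generalized metric. -/
def genMatInv (g gi B : Matrix (Fin n) (Fin n) R) : Matrix (GIdx n) (GIdx n) R :=
  Matrix.fromBlocks gi (-(gi * B)) (-(B.conjTranspose * gi))
    (g.transpose + B.conjTranspose * gi * B)

/-! ### The generalized metric in the frame sheared by the potential -/

section GenMat

/-- The matrix `P = (1, β; 0, 1)`. -/
def shear (B : Matrix (Fin n) (Fin n) R) : Matrix (GIdx n) (GIdx n) R :=
  Matrix.fromBlocks 1 B 0 1

variable {g gi B : Matrix (Fin n) (Fin n) R}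

omit [Algebra ℂ R] in
theorem isHermitian_inv {κ : Type} [Fintype κ] [DecidableEq κ] {h hi : Matrix κ κ R}
    (hh : h * hi = 1) (hH : h.IsHermitian) : hi.IsHermitian := by
  have h1 : hi.conjTranspose * h = 1 := by
    have := congrArg Matrix.conjTranspose hh
    rwa [Matrix.conjTranspose_mul, hH.eq, Matrix.conjTranspose_one] at this
  calc hi.conjTranspose = hi.conjTranspose * (h * hi) := by rw [hh, mul_one]
    _ = hi := by rw [← mul_assoc, h1, one_mul]

omit [Algebra ℂ R] in
-- The generalized metric is congruent to the block diagonal metric of `g` on `T^{1,0}` and its dual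
-- on `Λ^{1,0}`. Inverting and differentiating it thereby reduce to block computations.
theorem genMat_eq (g gi B : Matrix (Fin n) (Fin n) R) :
    genMat g gi B
      = shear B * Matrix.fromBlocks g 0 0 gi.transpose * (shear B).conjTranspose := by
  simp [genMat, shear, Matrix.fromBlocks_multiply, Matrix.fromBlocks_conjTranspose]

omit [Algebra ℂ R] in
theorem genMatInv_eq (g gi B : Matrix (Fin n) (Fin n) R) :
    genMatInv g gi B
      = (shear (-B)).conjTranspose * Matrix.fromBlocks gi 0 0 g.transpose * shear (-B) := by
  simp [genMatInv, shear, Matrix.fromBlocks_multiply, Matrix.fromBlocks_conjTranspose,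
    add_comm, mul_assoc]

omit [StarRing R] [Algebra ℂ R] in
theorem shear_mul_neg (B : Matrix (Fin n) (Fin n) R) : shear B * shear (-B) = 1 := by
  simp [shear, Matrix.fromBlocks_multiply]

omit [StarRing R] [Algebra ℂ R] in
theorem shear_neg_mul (B : Matrix (Fin n) (Fin n) R) : shear (-B) * shear B = 1 := by
  simp [shear, Matrix.fromBlocks_multiply]

omit [StarRing R] [Algebra ℂ R] in
theorem diag_mul_inv (hg : g * gi = 1) :
    Matrix.fromBlocks g 0 0 gi.transpose * Matrix.fromBlocks gi 0 0 g.transpose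
      = (1 : Matrix (GIdx n) (GIdx n) R) := by
  simp [Matrix.fromBlocks_multiply, hg, ← Matrix.transpose_mul]

omit [Algebra ℂ R] in
theorem genMat_mul_inv (hg : g * gi = 1) : genMat g gi B * genMatInv g gi B = 1 := by
  rw [genMat_eq, genMatInv_eq]
  calc _ = shear B * (Matrix.fromBlocks g 0 0 gi.transpose *
        ((shear (-B) * shear B).conjTranspose * Matrix.fromBlocks gi 0 0 g.transpose))
        * shear (-B) := by simp only [Matrix.conjTranspose_mul, mul_assoc]
    _ = 1 := by
      rw [shear_neg_mul, Matrix.conjTranspose_one, one_mul, diag_mul_inv hg, mul_one,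
        shear_mul_neg]

omit [Algebra ℂ R] in
theorem genMat_isHermitian (hg : g * gi = 1) (hH : g.IsHermitian) :
    (genMat g gi B).IsHermitian := by
  have hgi := isHermitian_inv hg hH
  have hc : gi.transpose.conjTranspose = gi.transpose := hgi.transpose.eq
  simp [genMat, Matrix.IsHermitian, Matrix.fromBlocks_conjTranspose, hH.eq, hc, mul_assoc]

/-- Derivative of a matrix conjugated by `P`. -/
theorem derivation_shear_conj (δ δ' : Derivation ℂ R R) (hδ : ∀ f, δ (star f) = star (δ' f))
    (B : Matrix (Fin n) (Fin n) R) (E : Matrix (GIdx n) (GIdx n) R) :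
    (shear B * E * (shear B).conjTranspose).map δ
      = shear B * (Matrix.fromBlocks 0 (B.map δ) 0 0 * E + E.map δ
          + E * Matrix.fromBlocks 0 0 (B.map δ').conjTranspose 0) * (shear B).conjTranspose := by
  have e1 : (shear B).map δ = shear B * Matrix.fromBlocks 0 (B.map δ) 0 0 := by
    simp [shear, Matrix.fromBlocks_multiply, Matrix.fromBlocks_map, derivation_map_one]
  have e2 : (shear B).conjTranspose.map δ
      = Matrix.fromBlocks 0 0 (B.map δ').conjTranspose 0 * (shear B).conjTranspose := by
    have : B.conjTranspose.map δ = (B.map δ').conjTranspose := by ext; simp [hδ]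
    simp [shear, Matrix.fromBlocks_multiply, Matrix.fromBlocks_conjTranspose,
      Matrix.fromBlocks_map, derivation_map_one, this]
  rw [derivation_map_mul, derivation_map_mul, e1, e2]
  simp only [mul_add, add_mul, mul_assoc]

/-- The derivative of the generalized metric in the frame sheared by `β`. -/
theorem derivation_genMat (δ δ' : Derivation ℂ R R) (hδ : ∀ f, δ (star f) = star (δ' f))
    (g gi B : Matrix (Fin n) (Fin n) R) :
    (genMat g gi B).map δ = shear B *
      Matrix.fromBlocks (g.map δ) (B.map δ * gi.transpose)
        (gi.transpose * (B.map δ').conjTranspose) (gi.transpose.map δ)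
        * (shear B).conjTranspose := by
  rw [genMat_eq, derivation_shear_conj δ δ' hδ]
  simp [Matrix.fromBlocks_multiply, Matrix.fromBlocks_map, Matrix.fromBlocks_add]

/-- The curvature of the generalized metric in the frame sheared by `β`. -/
theorem genMat_curv (hg : g * gi = 1) (k l : Fin n) :
    ((genMat g gi B).map (W.d l)).map (W.db k)
        - (genMat g gi B).map (W.d l) * genMatInv g gi B * (genMat g gi B).map (W.db k)
      = shear B * Matrix.fromBlocks
        ((g.map (W.d l)).map (W.db k) - g.map (W.d l) * gi * g.map (W.db k)
          + B.map (W.db k) * gi.transpose * (B.map (W.db l)).conjTranspose)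
        ((B.map (W.d l)).map (W.db k) * gi.transpose + B.map (W.db k) * gi.transpose.map (W.d l)
          - g.map (W.d l) * gi * (B.map (W.db k) * gi.transpose))
        (gi.transpose * ((B.map (W.db l)).map (W.d k)).conjTranspose
          + gi.transpose.map (W.db k) * (B.map (W.db l)).conjTranspose
          - gi.transpose * (B.map (W.db l)).conjTranspose * gi * g.map (W.db k))
        ((gi.transpose.map (W.d l)).map (W.db k)
          - gi.transpose.map (W.d l) * g.transpose * gi.transpose.map (W.db k)
          - gi.transpose * (B.map (W.db l)).conjTranspose * gi
            * (B.map (W.db k) * gi.transpose))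
        * (shear B).conjTranspose := by
  have hd := fun k f => (W.star_db k f).symm
  have hdb := fun k f => (W.star_d k f).symm
  have hc : gi.transpose * g.transpose = 1 := by
    rw [← Matrix.transpose_mul, hg, Matrix.transpose_one]
  have hc' : g.transpose * gi.transpose = 1 := mul_eq_one_comm.mp hc
  have hP : (shear B).conjTranspose * (shear (-B)).conjTranspose = 1 := by
    rw [← Matrix.conjTranspose_mul, shear_neg_mul, Matrix.conjTranspose_one]
  -- The shear factors around `G⁻¹` cancel, so `∂G G⁻¹ ∂̄G` is computed in the sheared frame with a
  -- block diagonal inverse. That `P` is not holomorphic is accounted for by the `β`-derivatives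
  -- inside the blocks.
  have key : ∀ E D F : Matrix (GIdx n) (GIdx n) R,
      shear B * E * (shear B).conjTranspose * ((shear (-B)).conjTranspose * D * shear (-B))
        * (shear B * F * (shear B).conjTranspose)
      = shear B * (E * D * F) * (shear B).conjTranspose := by
    intro E D F
    calc _ = shear B * E * ((shear B).conjTranspose * (shear (-B)).conjTranspose) * D
          * (shear (-B) * shear B) * F * (shear B).conjTranspose := by simp only [mul_assoc]
      _ = _ := by rw [hP, shear_neg_mul]; simp only [mul_one, mul_assoc]
  rw [derivation_genMat (W.d l) (W.db l) (hd l), derivation_genMat (W.db k) (W.d k) (hdb k),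
    derivation_shear_conj (W.db k) (W.d k) (hdb k), genMatInv_eq, key, ← sub_mul, ← mul_sub]
  congr 2
  simp only [Matrix.fromBlocks_multiply, Matrix.fromBlocks_map, Matrix.fromBlocks_add,
    sub_eq_add_neg, Matrix.fromBlocks_neg, derivation_map_mul, zero_mul, mul_zero, zero_add,
    add_zero]
  have e1 : ∀ X Y : Matrix (Fin n) (Fin n) R,
      X * gi.transpose * g.transpose * (gi.transpose * Y) = X * gi.transpose * Y := by
    intro X Y
    rw [mul_assoc X, hc, mul_one, mul_assoc]
  have e2 : ∀ X Y : Matrix (Fin n) (Fin n) R, X * gi.transpose * g.transpose * Y = X * Y := by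
    intro X Y
    rw [mul_assoc X, hc, mul_one]
  have e3 : ∀ X Y : Matrix (Fin n) (Fin n) R, X * g.transpose * (gi.transpose * Y) = X * Y := by
    intro X Y
    rw [mul_assoc X, ← mul_assoc _ _ Y, hc', one_mul]
  have e4 : ((B.map (W.db l)).conjTranspose).map (W.db k)
      = ((B.map (W.db l)).map (W.d k)).conjTranspose := by rw [W.conjTranspose_map_d]
  simp only [e1, e2, e3, e4]
  simp only [mul_assoc]
  congr 1 <;> abel

end GenMat

/-! ### Evolution of the metric, the potential and the generalized metric -/

namespace IsFlow

variable {W} {g gi B : Matrix (Fin n) (Fin n) R} (hF : W.IsFlow g gi B)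

include hF

theorem isHermitian_gi : gi.IsHermitian := isHermitian_inv hF.mul_inv hF.isHermitian

theorem star_torsLow (i j k : Fin n) :
    star (W.torsLow g i j k) = W.db i (g k j) - W.db j (g k i) := by
  rw [torsLow, star_sub, W.star_d, W.star_d, hF.isHermitian.apply, hF.isHermitian.apply]

/-- The torsion is `√-1 ∂̄β`, so this is the symmetry of `∂_{j̄} ∂_{l̄} β`: a metric with a torsion
potential is pluriclosed. -/
theorem pluriclosed (i a j l : Fin n) :
    W.db j (W.torsLow g i a l) = W.db l (W.torsLow g i a j) := by
  have h := W.db_db j l (B i a)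
  rw [hF.potential, hF.potential, map_neg, map_neg, Derivation.map_smul, Derivation.map_smul] at h
  have h' := congrArg (fun x => Complex.I • x) (neg_injective h)
  simpa only [smul_smul, Complex.I_mul_I, neg_smul, one_smul, neg_inj] using h'

omit hF [StarRing R] [Algebra ℂ R] in
-- The two contractions with `g⁻¹` are interchangeable. Expansions quadratic in first derivatives
-- agree only after this relabelling.
theorem sum_swap_pairs (gi : Matrix (Fin n) (Fin n) R) (F : Fin n → Fin n → Fin n → Fin n → R) :
    ∑ k, ∑ l, ∑ q, ∑ p, gi k l * gi q p * F k l q p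
      = ∑ k, ∑ l, ∑ q, ∑ p, gi k l * gi q p * F q p k l := by
  calc _ = ∑ x : (Fin n × Fin n) × (Fin n × Fin n),
        gi x.1.1 x.1.2 * gi x.2.1 x.2.2 * F x.1.1 x.1.2 x.2.1 x.2.2 := by
        simp only [Fintype.sum_prod_type]
    _ = ∑ x : (Fin n × Fin n) × (Fin n × Fin n),
        gi x.1.1 x.1.2 * gi x.2.1 x.2.2 * F x.2.1 x.2.2 x.1.1 x.1.2 :=
        Fintype.sum_equiv (Equiv.prodComm _ _) _ _ fun x => by
          simp only [Equiv.prodComm_apply, Prod.fst_swap, Prod.snd_swap]; ring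
    _ = _ := by simp only [Fintype.sum_prod_type]

theorem derivation_gi (δ : Derivation ℂ R R) (l a : Fin n) :
    δ (gi l a) = -∑ p, ∑ q, gi l p * gi q a * δ (g p q) := by
  have h := congrFun (congrFun (derivation_map_inv δ hF.mul_inv) l) a
  rw [Matrix.map_apply, Matrix.neg_apply, Matrix.mul_apply] at h
  simp only [Matrix.mul_apply, Matrix.map_apply, Finset.sum_mul] at h
  rw [h, Finset.sum_comm]
  exact congrArg _ (Finset.sum_congr rfl fun p _ => Finset.sum_congr rfl fun q _ => by ring)

theorem sum_mul_derivation (l a : Fin n) (δ : Derivation ℂ R R) (f : R) :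
    ∑ p, ∑ q, gi l p * gi q a * (f * δ (g p q)) = -(f * δ (gi l a)) := by
  rw [hF.derivation_gi, mul_neg, neg_neg, Finset.mul_sum]
  refine Finset.sum_congr rfl fun p _ => ?_
  rw [Finset.mul_sum]
  exact Finset.sum_congr rfl fun q _ => by ring

omit hF [StarRing R] [Algebra ℂ R] in
theorem sum_reorder (gi : Matrix (Fin n) (Fin n) R) (F : Fin n → Fin n → Fin n → Fin n → R) :
    ∑ a, ∑ l, ∑ p, ∑ q, gi l p * gi q a * F l p q a
      = ∑ k, ∑ l, ∑ q, ∑ p, gi k l * gi q p * F k l q p := by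
  rw [Finset.sum_comm]
  refine Finset.sum_congr rfl fun k _ => ?_
  rw [Finset.sum_comm]
  exact Finset.sum_congr rfl fun l _ => Finset.sum_comm

/-- The evolution of the metric, `∂_t g = -S + Q`. -/
theorem metric_evolution : g.map W.dt = W.curvTrace gi g gi + W.torsSq g gi := by
  ext i j
  have e1 := sum_reorder gi
  have lhs : W.dt (g i j) = ∑ k, ∑ l, gi k l * W.db k (W.d l (g i j))
      + ∑ k, ∑ l, ∑ q, ∑ p, gi k l * gi q p *
        ((W.db j (g p k) - W.db k (g p j)) * W.d i (g l q) - W.d p (g i k) * W.db j (g l q)) := by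
    rw [hF.dt_metric, ← e1, Finset.sum_comm (f := fun k l => gi k l * W.db k (W.d l (g i j))),
      ← Finset.sum_add_distrib, ← Finset.sum_neg_distrib]
    refine Finset.sum_congr rfl fun a _ => ?_
    rw [map_sum, map_sum, ← Finset.sum_sub_distrib, ← Finset.sum_neg_distrib,
      ← Finset.sum_add_distrib]
    refine Finset.sum_congr rfl fun l _ => ?_
    -- The second derivatives in the Bismut-Ricci form are not of Laplacian type; the pluriclosed
    -- identity collapses them to `g^{l̄ a} ∂_a ∂_{l̄} g_{i j̄}`.
    have h1 := hF.pluriclosed i a j l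
    simp only [torsLow, map_sub] at h1
    simp only [mul_sub, Finset.sum_sub_distrib]
    rw [hF.sum_mul_derivation, hF.sum_mul_derivation]
    simp only [Derivation.leibniz, smul_eq_mul, map_sub, W.d_db]
    linear_combination (-gi l a) * h1
  have s1 := sum_swap_pairs gi fun k l q p => W.d i (g p k) * W.db j (g l q)
  have s2 := sum_swap_pairs gi fun k l q p => W.d i (g p k) * W.db q (g l j)
  have s3 := sum_swap_pairs gi fun k l q p => W.d p (g i k) * W.db q (g l j)
  have rhs1 : W.curvTrace gi g gi i j = ∑ k, ∑ l, gi k l * W.db k (W.d l (g i j))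
      - ∑ k, ∑ l, ∑ q, ∑ p, gi k l * gi q p * (W.d l (g i q) * W.db k (g p j)) := by
    simp only [curvTrace, Matrix.sum_apply, Matrix.smul_apply, Matrix.sub_apply, smul_eq_mul,
      mul_sub, Finset.sum_sub_distrib, Matrix.map_apply]
    congr 1
    refine Finset.sum_congr rfl fun k _ => Finset.sum_congr rfl fun l _ => ?_
    simp only [Matrix.mul_apply, Matrix.map_apply, Finset.sum_mul, Finset.mul_sum]
    rw [Finset.sum_comm]
    exact Finset.sum_congr rfl fun q _ => Finset.sum_congr rfl fun p _ => by ring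
  rw [Matrix.map_apply, Matrix.add_apply, lhs, rhs1, torsSq, Matrix.of_apply]
  simp only [hF.star_torsLow]
  simp only [torsLow, mul_sub, sub_mul, Finset.sum_sub_distrib]
    at s1 s2 s3 ⊢
  simp only [mul_comm (W.db _ _) (W.d _ _)]
  rw [s1, s2, s3]
  ring

/-- The evolution of the torsion potential, `∂_t β = Δβ`. -/
theorem potential_evolution : B.map W.dt = ∑ k, ∑ l, gi k l •
    ((B.map (W.d l)).map (W.db k) - B.map (W.db k) * (g.map (W.d l) * gi).transpose
      - g.map (W.d l) * gi * B.map (W.db k)) := by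
  ext i j
  have e1 := sum_reorder gi
  -- Second derivatives of `g` combine to `∂_a T_{ij l̄}`, and derivatives of `g⁻¹` give the
  -- quadratic terms.
  have lhs : ∑ a, (
        W.d i (∑ l, W.d a (g j l) * gi l a) - W.d j (∑ l, W.d a (g i l) * gi l a))
      = ∑ k, ∑ l, gi k l * W.d l (W.torsLow g i j k)
        + ∑ k, ∑ l, ∑ q, ∑ p, gi k l * gi q p *
          (W.d p (g i k) * W.d j (g l q) - W.d p (g j k) * W.d i (g l q)) := by
    rw [← e1, Finset.sum_comm (f := fun k l => gi k l * W.d l (W.torsLow g i j k)),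
      ← Finset.sum_add_distrib]
    refine Finset.sum_congr rfl fun a _ => ?_
    rw [map_sum, map_sum, ← Finset.sum_sub_distrib, ← Finset.sum_add_distrib]
    refine Finset.sum_congr rfl fun l _ => ?_
    simp only [mul_sub, Finset.sum_sub_distrib]
    rw [hF.sum_mul_derivation, hF.sum_mul_derivation]
    simp only [torsLow, map_sub, Derivation.leibniz, smul_eq_mul, W.d_d a]
    ring
  have s1 := sum_swap_pairs gi fun k l q p => W.d i (g p k) * W.d l (g j q)
  have s2 := sum_swap_pairs gi fun k l q p => W.d p (g i k) * W.d l (g j q)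
  have s3 := sum_swap_pairs gi fun k l q p => W.d l (g i q) * W.d j (g p k)
  have rhs : ∀ k l : Fin n, ∑ p, W.torsLow g i p k * ∑ q, W.d l (g j q) * gi q p
      = ∑ q, ∑ p, gi q p * (W.torsLow g i p k * W.d l (g j q)) := by
    intro k l
    rw [Finset.sum_comm]
    refine Finset.sum_congr rfl fun p _ => ?_
    rw [Finset.mul_sum]
    exact Finset.sum_congr rfl fun q _ => by ring
  have rhs' : ∀ k l : Fin n, ∑ p, (∑ q, W.d l (g i q) * gi q p) * W.torsLow g p j k
      = ∑ q, ∑ p, gi q p * (W.d l (g i q) * W.torsLow g p j k) := by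
    intro k l
    rw [Finset.sum_comm]
    refine Finset.sum_congr rfl fun p _ => ?_
    rw [Finset.sum_mul]
    exact Finset.sum_congr rfl fun q _ => by ring
  -- Replacing `∂̄β` by `-√-1 T` turns the second covariant derivative of `β` into a covariant
  -- derivative of the torsion, comparable with the Ricci side.
  have pull : ∀ k l : Fin n,
      ((B.map (W.d l)).map (W.db k) - B.map (W.db k) * (g.map (W.d l) * gi).transpose
        - g.map (W.d l) * gi * B.map (W.db k)) i j
      = -(Complex.I • (W.d l (W.torsLow g i j k)
          - ∑ q, ∑ p, gi q p * (W.torsLow g i p k * W.d l (g j q))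
          - ∑ q, ∑ p, gi q p * (W.d l (g i q) * W.torsLow g p j k))) := by
    intro k l
    rw [← rhs, ← rhs']
    simp only [Matrix.sub_apply, Matrix.map_apply, Matrix.mul_apply, Matrix.transpose_apply,
      ← W.d_db, hF.potential, map_neg, Derivation.map_smul, neg_mul, mul_neg, smul_mul_assoc,
      mul_smul_comm, Finset.sum_neg_distrib, ← Finset.smul_sum, smul_sub]
    abel
  rw [Matrix.map_apply, hF.dt_potential, lhs]
  simp only [Matrix.sum_apply, Matrix.smul_apply, pull, smul_eq_mul, mul_neg, mul_smul_comm,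
    Finset.sum_neg_distrib, ← Finset.smul_sum]
  congr 2
  simp only [mul_sub, Finset.sum_sub_distrib, Finset.mul_sum, ← mul_assoc (gi _ _) (gi _ _)]
  simp only [torsLow, mul_sub, sub_mul, Finset.sum_sub_distrib] at s1 s2 s3 ⊢
  rw [s1, s2, s3]
  simp only [mul_comm (W.d _ (g _ _)) (W.d _ (g _ _))]
  ring

omit hF [StarRing R] [Algebra ℂ R] in
theorem sum_fromBlocks {α : Type*} (s : Finset α) (a b c d : α → Matrix (Fin n) (Fin n) R) :
    ∑ x ∈ s, Matrix.fromBlocks (a x) (b x) (c x) (d x)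
      = Matrix.fromBlocks (∑ x ∈ s, a x) (∑ x ∈ s, b x) (∑ x ∈ s, c x) (∑ x ∈ s, d x) := by
  ext i j
  rcases i with i | i <;> rcases j with j | j <;> simp [Matrix.sum_apply]

variable [StarModule ℂ R] in
/-- The generalized metric evolves by `∂_t G = -g^{k̄ l} Ω_{l k̄}`. -/
theorem genMat_evolution :
    (genMat g gi B).map W.dt = W.curvTrace gi (genMat g gi B) (genMatInv g gi B) := by
  have hc : gi.transpose * g.transpose = 1 := by
    rw [← Matrix.transpose_mul, hF.mul_inv, Matrix.transpose_one]
  have hc' : g.transpose * gi.transpose = 1 := mul_eq_one_comm.mp hc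
  have hcH : gi.transpose.conjTranspose = gi.transpose := hF.isHermitian_gi.transpose.eq
  have dc : ∀ δ : Derivation ℂ R R,
      gi.transpose.map δ = -(gi.transpose * (g.map δ).transpose * gi.transpose) := fun δ => by
    rw [derivation_map_inv δ hc', Matrix.transpose_map]
  -- The factors `-√-1` and its conjugate multiply to one, so `Q` is the term quadratic in `∂̄β`
  -- that appears in the curvature of `G`.
  have sq : W.torsSq g gi = ∑ k, ∑ l, gi k l •
      (B.map (W.db k) * gi.transpose * (B.map (W.db l)).conjTranspose) := by
    ext i j
    simp only [torsSq, Matrix.of_apply, Matrix.sum_apply, Matrix.smul_apply, smul_eq_mul]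
    refine Finset.sum_congr rfl fun k _ => Finset.sum_congr rfl fun l _ => ?_
    simp only [Matrix.mul_apply, Matrix.map_apply, Matrix.transpose_apply,
      Matrix.conjTranspose_apply, hF.potential, Finset.sum_mul, Finset.mul_sum]
    refine Finset.sum_congr rfl fun q _ => Finset.sum_congr rfl fun p _ => ?_
    have hI : star Complex.I = -Complex.I := Complex.conj_I
    simp only [star_neg, star_smul, hI, neg_smul, neg_neg, neg_mul, smul_mul_assoc,
      mul_smul_comm, smul_neg, smul_smul, Complex.I_mul_I, one_smul]
    ring
  have b12 : B.map W.dt * gi.transpose = ∑ k, ∑ l, gi k l •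
      ((B.map (W.d l)).map (W.db k) * gi.transpose + B.map (W.db k) * gi.transpose.map (W.d l)
        - g.map (W.d l) * gi * (B.map (W.db k) * gi.transpose)) := by
    rw [hF.potential_evolution]
    simp only [Finset.sum_mul, smul_mul_assoc, dc]
    refine Finset.sum_congr rfl fun k _ => Finset.sum_congr rfl fun l _ => ?_
    congr 1
    simp only [sub_mul, mul_neg, Matrix.transpose_mul, mul_assoc, ← sub_eq_add_neg]
  have b21 : gi.transpose * (B.map W.dt).conjTranspose = ∑ k, ∑ l, gi k l •
      (gi.transpose * ((B.map (W.db l)).map (W.d k)).conjTranspose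
        + gi.transpose.map (W.db k) * (B.map (W.db l)).conjTranspose
        - gi.transpose * (B.map (W.db l)).conjTranspose * gi * g.map (W.db k)) := by
    have h := congrArg Matrix.conjTranspose b12
    rw [Matrix.conjTranspose_mul, hcH] at h
    rw [h, Matrix.conjTranspose_sum, Finset.sum_comm]
    simp only [Matrix.conjTranspose_sum]
    refine Finset.sum_congr rfl fun k _ => ?_
    refine Finset.sum_congr rfl fun l _ => ?_
    rw [Matrix.conjTranspose_smul, hF.isHermitian_gi.apply]
    simp only [Matrix.conjTranspose_sub, Matrix.conjTranspose_add, Matrix.conjTranspose_mul, hcH,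
      W.conjTranspose_map_d (gi.transpose), W.conjTranspose_map_d g, hF.isHermitian.eq,
      hF.isHermitian_gi.eq, W.map_d_db, mul_assoc]
  have b22 : gi.transpose.map W.dt = ∑ k, ∑ l, gi k l •
      ((gi.transpose.map (W.d l)).map (W.db k)
        - gi.transpose.map (W.d l) * g.transpose * gi.transpose.map (W.db k)
        - gi.transpose * (B.map (W.db l)).conjTranspose * gi
          * (B.map (W.db k) * gi.transpose)) := by
    -- Evolving `g⁻ᵀ` involves the transpose of `Q`; skew symmetry of `β` makes its two sign changes
    -- cancel, which matches the `∂̄β`-term of the curvature.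
    have hBt : ∀ k, (B.map (W.db k)).transpose = -B.map (W.db k) := fun k => by
      rw [← Matrix.transpose_map, hF.alt, derivation_map_neg]
    have hBt' : ∀ k, (B.map (W.db k)).conjTranspose.transpose
        = -(B.map (W.db k)).conjTranspose := fun k => by
      ext i j
      have h := congrFun (congrFun (hBt k) j) i
      simp only [Matrix.transpose_apply, Matrix.neg_apply] at h
      simp only [Matrix.transpose_apply, Matrix.conjTranspose_apply, Matrix.neg_apply, h, star_neg]
    rw [dc, hF.metric_evolution, sq, curvTrace]
    simp only [← Finset.sum_add_distrib, ← smul_add, Matrix.transpose_sum, Matrix.transpose_smul,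
      Finset.mul_sum, Finset.sum_mul, mul_smul_comm, smul_mul_assoc, ← Finset.sum_neg_distrib,
      ← smul_neg]
    refine Finset.sum_congr rfl fun k _ => Finset.sum_congr rfl fun l _ => ?_
    congr 1
    simp only [dc, derivation_map_neg, derivation_map_mul, Matrix.transpose_map,
      Matrix.transpose_add, Matrix.transpose_sub, Matrix.transpose_mul, hBt, hBt',
      Matrix.transpose_transpose]
    have c2 : ∀ X : Matrix (Fin n) (Fin n) R, g.transpose * (gi.transpose * X) = X := fun X => by
      rw [← mul_assoc, hc', one_mul]
    simp only [mul_add, add_mul, mul_sub, sub_mul, mul_neg, neg_mul, neg_neg, mul_assoc, c2]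
    abel
  have comm := fun f => (W.star_dt f).symm
  rw [derivation_genMat W.dt W.dt comm, curvTrace]
  have push : ∀ (f : R) (X : Matrix (GIdx n) (GIdx n) R),
      f • (shear B * X * (shear B).conjTranspose)
        = shear B * (f • X) * (shear B).conjTranspose := fun f X => by
    rw [mul_smul_comm, smul_mul_assoc]
  simp only [W.genMat_curv hF.mul_inv, push, ← Finset.sum_mul,
    ← Finset.mul_sum, Matrix.fromBlocks_smul, sum_fromBlocks]
  rw [← b12, ← b21, ← b22, hF.metric_evolution, sq]
  simp only [curvTrace, smul_add, Finset.sum_add_distrib]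

end IsFlow

end WirtingerCalculus

/-- The Wirtinger calculus of commuting real derivations `∂/∂x^k`, `∂/∂y^k`, `∂_t`. -/
def WirtingerCalculus.ofReal {R : Type*} [CommRing R] [StarRing R] [Algebra ℂ R] [StarModule ℂ R]
    {n : ℕ} (X Y : Fin n → Derivation ℂ R R) (T : Derivation ℂ R R) (A : Set (Derivation ℂ R R))
    (hX : ∀ k, X k ∈ A) (hY : ∀ k, Y k ∈ A) (hT : T ∈ A)
    (hc : ∀ D ∈ A, ∀ D' ∈ A, ∀ f, D (D' f) = D' (D f))
    (hs : ∀ D ∈ A, ∀ f, star (D f) = D (star f)) : WirtingerCalculus n R :=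
  have hI : star Complex.I = -Complex.I := Complex.conj_I
  have h2 : star ((1 : ℂ) / 2) = 1 / 2 := by simp
  { d := fun k => ((1 : ℂ) / 2) • (X k - Complex.I • Y k)
    db := fun k => ((1 : ℂ) / 2) • (X k + Complex.I • Y k)
    dt := T
    star_d := fun k f => by
      simp only [Derivation.smul_apply, Derivation.sub_apply, Derivation.add_apply, star_smul,
        star_sub, h2, hI, hs _ (hX k), hs _ (hY k), neg_smul, sub_neg_eq_add]
    star_dt := hs _ hT
    d_d := fun k l f => by
      simp only [Derivation.smul_apply, Derivation.sub_apply, Derivation.map_smul,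
        Derivation.map_sub, hc _ (hX l) _ (hX k), hc _ (hX l) _ (hY k), hc _ (hY l) _ (hX k),
        hc _ (hY l) _ (hY k)]
      module
    d_db := fun k l f => by
      simp only [Derivation.smul_apply, Derivation.sub_apply, Derivation.add_apply,
        Derivation.map_smul, Derivation.map_add, Derivation.map_sub, hc _ (hX l) _ (hX k),
        hc _ (hX l) _ (hY k), hc _ (hY l) _ (hX k), hc _ (hY l) _ (hY k)]
      module
    dt_d := fun k f => by
      simp only [Derivation.smul_apply, Derivation.sub_apply, Derivation.map_smul,
        Derivation.map_sub, hc _ hT _ (hX k), hc _ hT _ (hY k)] }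

/-! ## The ring of smooth functions on a set with dense interior -/

section SmoothRing

variable {E : Type*} [NormedAddCommGroup E] [NormedSpace ℝ E]

/-- The complex-valued smooth functions on `S`, as a star subalgebra of all functions. -/
def smoothRing (S : Set E) : StarSubalgebra ℂ (S → ℂ) where
  carrier := {f | ∃ F : E → ℂ, ContDiffOn ℝ ∞ F S ∧ ∀ p : S, F p = f p}
  mul_mem' := by
    rintro f g ⟨F, hF, hf⟩ ⟨G, hG, hg⟩
    exact ⟨fun x => F x * G x, hF.mul hG, fun p => by simp [hf, hg]⟩
  add_mem' := by
    rintro f g ⟨F, hF, hf⟩ ⟨G, hG, hg⟩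
    exact ⟨fun x => F x + G x, hF.add hG, fun p => by simp [hf, hg]⟩
  algebraMap_mem' c := ⟨fun _ => c, contDiffOn_const, fun _ => rfl⟩
  star_mem' := by
    rintro f ⟨F, hF, hf⟩
    exact ⟨fun x => conj (F x), Complex.conjCLE.contDiff.comp_contDiffOn hF, fun p => by simp [hf]⟩

namespace smoothRing

variable {S : Set E}

/-- A smooth extension of `f`. -/
def lift (f : smoothRing S) : E → ℂ := f.2.choose

theorem contDiffOn_lift (f : smoothRing S) : ContDiffOn ℝ ∞ (lift f) S := f.2.choose_spec.1

theorem lift_apply (f : smoothRing S) (p : S) : lift f p = f.1 p := f.2.choose_spec.2 p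

theorem differentiableWithinAt_lift (f : smoothRing S) (p : S) :
    DifferentiableWithinAt ℝ (lift f) S p :=
  (contDiffOn_lift f).differentiableOn (by simp) p p.2

/-- Evaluation at a point. -/
def ev (p : S) : smoothRing S →ₐ[ℂ] ℂ :=
  (Pi.evalAlgHom ℂ (fun _ : S => ℂ) p).comp (smoothRing S).toSubalgebra.val

theorem ev_star (p : S) (f : smoothRing S) : ev p (star f) = conj (ev p f) := rfl

theorem ext_ev {f g : smoothRing S} (h : ∀ p, ev p f = ev p g) : f = g :=
  Subtype.ext (funext h)

variable (hS : UniqueDiffOn ℝ S)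

omit hS in
-- Derivatives within `S` see only values on `S`, so the chosen extension may be replaced by any
-- convenient one.
theorem fderivWithin_lift {f : smoothRing S} {F : E → ℂ} (h : ∀ p : S, F p = f.1 p) (p : S) :
    fderivWithin ℝ (lift f) S p = fderivWithin ℝ F S p :=
  fderivWithin_congr (fun x hx => by rw [lift_apply f ⟨x, hx⟩, h ⟨x, hx⟩])
    (by rw [lift_apply, h])

/-- The directional derivative along `v`. -/
def dir (v : E) : Derivation ℂ (smoothRing S) (smoothRing S) :=
  Derivation.mk'
    { toFun := fun f => ⟨fun p => fderivWithin ℝ (lift f) S p v,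
        fun x => fderivWithin ℝ (lift f) S x v,
        ((contDiffOn_lift f).fderivWithin hS (by simp)).clm_apply contDiffOn_const, fun _ => rfl⟩
      map_add' := fun f g => Subtype.ext <| funext fun p => by
        change fderivWithin ℝ (lift (f + g)) S p v
          = fderivWithin ℝ (lift f) S p v + fderivWithin ℝ (lift g) S p v
        rw [fderivWithin_lift (F := fun x => lift f x + lift g x)
          (fun q => by rw [lift_apply, lift_apply]; rfl), fderivWithin_fun_add (hS p p.2)
          (differentiableWithinAt_lift f p) (differentiableWithinAt_lift g p)]
        rfl
      map_smul' := fun c f => Subtype.ext <| funext fun p => by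
        change fderivWithin ℝ (lift (c • f)) S p v = c • fderivWithin ℝ (lift f) S p v
        rw [fderivWithin_lift (F := fun x => c • lift f x)
          (fun q => by rw [lift_apply]; rfl), fderivWithin_fun_const_smul (hS p p.2)
          (differentiableWithinAt_lift f p)]
        rfl }
    fun f g => Subtype.ext <| funext fun p => by
      change fderivWithin ℝ (lift (f * g)) S p v
        = f.1 p * fderivWithin ℝ (lift g) S p v + g.1 p * fderivWithin ℝ (lift f) S p v
      rw [fderivWithin_lift (F := fun x => lift f x * lift g x)
          (fun q => by rw [lift_apply, lift_apply]; rfl), fderivWithin_fun_mul (hS p p.2)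
          (differentiableWithinAt_lift f p) (differentiableWithinAt_lift g p)]
      simp [lift_apply]

theorem ev_dir (v : E) (f : smoothRing S) (p : S) :
    ev p (dir hS v f) = fderivWithin ℝ (lift f) S p v := rfl

theorem star_dir (v : E) (f : smoothRing S) : star (dir hS v f) = dir hS v (star f) := by
  refine ext_ev fun p => ?_
  rw [ev_star, ev_dir, ev_dir, fderivWithin_lift (f := star f) (F := fun x => conj (lift f x))
    (fun q => by rw [lift_apply]; rfl)]
  have h := ((Complex.conjCLE : ℂ →L[ℝ] ℂ).hasFDerivAt.comp_hasFDerivWithinAt (p : E)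
    (differentiableWithinAt_lift f p).hasFDerivWithinAt).fderivWithin (hS p p.2)
  exact (congrArg (fun L : E →L[ℝ] ℂ => L v) h).symm

/-- Symmetry of the second derivative extends from the interior to the points of `S` in its closure;
this is how the end points of the time interval are reached. -/
theorem dir_comm (hS' : S ⊆ closure (interior S)) (v w : E) (f : smoothRing S) :
    dir hS v (dir hS w f) = dir hS w (dir hS v f) := by
  have key : ∀ v w (p : S), ev p (dir hS v (dir hS w f))
      = fderivWithin ℝ (fderivWithin ℝ (lift f) S) S p v w := by
    intro v w p
    rw [ev_dir, fderivWithin_lift (F := fun x => fderivWithin ℝ (lift f) S x w) fun _ => rfl]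
    have hd : DifferentiableWithinAt ℝ (fderivWithin ℝ (lift f) S) S p :=
      ((contDiffOn_lift f).fderivWithin (m := ∞) hS (by simp)).differentiableOn
        (by simp) p p.2
    have h := (((ContinuousLinearMap.apply ℝ ℂ w).hasFDerivAt.comp_hasFDerivWithinAt (p : E)
      hd.hasFDerivWithinAt)).fderivWithin (hS p p.2)
    exact congrArg (fun L : E →L[ℝ] ℂ => L v) h
  refine ext_ev fun p => ?_
  rw [key, key]
  exact ((contDiffOn_lift f) p p.2).isSymmSndFDerivWithinAt
    (by rw [minSmoothness_of_isRCLikeNormedField]; exact ENat.LEInfty.out) hS (hS' p.2) p.2 v w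

/-- Smooth functions without zeros are invertible. -/
theorem isUnit_of_ev_ne_zero (f : smoothRing S) (h : ∀ p, ev p f ≠ 0) : IsUnit f := by
  refine IsUnit.of_mul_eq_one ⟨fun p => (f.1 p)⁻¹, fun x => (lift f x)⁻¹,
    (contDiffOn_lift f).inv fun x hx => ?_, fun p => congrArg _ (lift_apply f p)⟩ ?_
  · rw [lift_apply f ⟨x, hx⟩]
    exact h ⟨x, hx⟩
  · exact ext_ev fun p => mul_inv_cancel₀ (h p)

end smoothRing

end SmoothRing

/-! ## Wirtinger calculus on `J × U` -/

namespace smoothRing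

/-- Two distinct points give an open interval inside `J`, and a convex set with nonempty interior
has the same closure as its interior. -/
theorem subset_closure_interior {J : Set ℝ} (hJ : J.OrdConnected) (hJ' : J.Nontrivial) :
    (interior J).Nonempty ∧ J ⊆ closure (interior J) := by
  have hne : (interior J).Nonempty := by
    obtain ⟨a, ha, b, hb, hab⟩ := hJ'.exists_lt
    obtain ⟨c, hc⟩ := exists_between hab
    exact ⟨c, mem_interior.mpr ⟨Set.Ioo a b, Set.Ioo_subset_Icc_self.trans (hJ.out ha hb),
      isOpen_Ioo, hc⟩⟩
  exact ⟨hne, by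
    have hconv : Convex ℝ J := hJ.convex
    rw [hconv.closure_interior_eq_closure_of_nonempty_interior hne]
    exact subset_closure⟩

variable {n : ℕ} {J : Set ℝ} {U : Set (Cn n)}

theorem uniqueDiffOn_time (hJ : J.OrdConnected) (hJ' : J.Nontrivial) : UniqueDiffOn ℝ J :=
  uniqueDiffOn_convex hJ.convex (subset_closure_interior hJ hJ').1

theorem uniqueDiffOn_prod (hJ : J.OrdConnected) (hJ' : J.Nontrivial) (hU : IsOpen U) :
    UniqueDiffOn ℝ (J ×ˢ U) :=
  (uniqueDiffOn_time hJ hJ').prod hU.uniqueDiffOn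

theorem prod_subset_closure_interior (hJ : J.OrdConnected) (hJ' : J.Nontrivial)
    (hU : IsOpen U) : J ×ˢ U ⊆ closure (interior (J ×ˢ U)) := by
  rw [interior_prod_eq, closure_prod_eq, hU.interior_eq]
  exact Set.prod_mono (subset_closure_interior hJ hJ').2 subset_closure

/-- The Wirtinger calculus of smooth functions of `(t, z) ∈ J × U`. -/
def calculus (hJ : J.OrdConnected) (hJ' : J.Nontrivial) (hU : IsOpen U) :
    WirtingerCalculus n (smoothRing (J ×ˢ U)) :=
  let D := dir (uniqueDiffOn_prod hJ hJ' hU)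
  .ofReal (fun k => D (0, Pi.single k 1)) (fun k => D (0, Pi.single k Complex.I)) (D (1, 0))
    {δ | ∃ v, δ = D v} (fun _ => ⟨_, rfl⟩) (fun _ => ⟨_, rfl⟩) ⟨_, rfl⟩
    (by
      rintro _ ⟨v, rfl⟩ _ ⟨w, rfl⟩ f
      exact dir_comm _ (prod_subset_closure_interior hJ hJ' hU) v w f)
    (by
      rintro _ ⟨v, rfl⟩ f
      exact star_dir _ v f)

end smoothRing

/-! ## Time slices of smooth functions on `J × U` -/

namespace smoothRing

variable {n : ℕ} {J : Set ℝ} {U : Set (Cn n)}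

/-- The point `(t, z)` of `J × U`. -/
def pt {t : ℝ} {z : Cn n} (ht : t ∈ J) (hz : z ∈ U) : ↥(J ×ˢ U) := ⟨(t, z), ht, hz⟩

/-- `φ` is on `U` the time slice of `f` at `t`. -/
def IsSlice {t : ℝ} (ht : t ∈ J) (φ : Cn n → ℂ) (f : smoothRing (J ×ˢ U)) : Prop :=
  ∀ w (hw : w ∈ U), φ w = ev (pt ht hw) f

/-- `h` is on `U` the time slice of `H` at `t`. -/
def IsMatSlice {ι : Type} {t : ℝ} (ht : t ∈ J) (h : Cn n → Matrix ι ι ℂ)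
    (H : Matrix ι ι (smoothRing (J ×ˢ U))) : Prop :=
  ∀ w (hw : w ∈ U), h w = H.map (ev (pt ht hw))

variable (hJ : J.OrdConnected) (hJ' : J.Nontrivial) (hU : IsOpen U) {t : ℝ} {ht : t ∈ J}

include hU in
-- Chain rule along `w ↦ (t, w)`. As `U` is open, the derivative within `U` is the full one, even
-- when `t` is an end point of `J`.
theorem IsSlice.fderiv {φ : Cn n → ℂ} {f : smoothRing (J ×ˢ U)} (h : IsSlice ht φ f)
    {z : Cn n} (hz : z ∈ U) (v : Cn n) :
    fderiv ℝ φ z v = fderivWithin ℝ (lift f) (J ×ˢ U) (t, z) (0, v) := by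
  have h1 : HasFDerivWithinAt (lift f) (fderivWithin ℝ (lift f) (J ×ˢ U) (t, z)) (J ×ˢ U) (t, z) :=
    (differentiableWithinAt_lift f (pt ht hz)).hasFDerivWithinAt
  have h2 : HasFDerivWithinAt (fun w : Cn n => (t, w))
      ((0 : Cn n →L[ℝ] ℝ).prod (ContinuousLinearMap.id ℝ (Cn n))) U z :=
    ((hasFDerivAt_const t z).prodMk (hasFDerivAt_id z)).hasFDerivWithinAt
  have h3 := h1.comp z h2 fun w hw => ⟨ht, hw⟩
  have h4 : HasFDerivWithinAt φ _ U z :=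
    h3.congr (fun w hw => (h w hw).trans (lift_apply f (pt ht hw)).symm)
      ((h z hz).trans (lift_apply f (pt ht hz)).symm)
  rw [(h4.hasFDerivAt (hU.mem_nhds hz)).fderiv]
  rfl

theorem IsSlice.dz {φ : Cn n → ℂ} {f : smoothRing (J ×ˢ U)} (h : IsSlice ht φ f) (k : Fin n) :
    IsSlice ht (dz k φ) ((calculus hJ hJ' hU).d k f) := by
  intro z hz
  rw [PCF.dz, h.fderiv hU hz, h.fderiv hU hz]
  simp only [calculus, WirtingerCalculus.ofReal, Derivation.smul_apply, Derivation.sub_apply,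
    map_smul, map_sub, ev_dir, pt, smul_eq_mul]
  ring

theorem IsSlice.dzbar {φ : Cn n → ℂ} {f : smoothRing (J ×ˢ U)} (h : IsSlice ht φ f) (k : Fin n) :
    IsSlice ht (dzbar k φ) ((calculus hJ hJ' hU).db k f) := by
  intro z hz
  rw [PCF.dzbar, h.fderiv hU hz, h.fderiv hU hz]
  simp only [calculus, WirtingerCalculus.ofReal, Derivation.smul_apply, Derivation.add_apply,
    map_smul, map_add, ev_dir, pt, smul_eq_mul]
  ring

/-- The time derivative along a fixed point. -/
theorem hasDerivWithinAt_ev (f : smoothRing (J ×ˢ U)) {z : Cn n} (hz : z ∈ U) {ψ : ℝ → ℂ}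
    (hψ : ∀ s (hs : s ∈ J), ψ s = ev (pt hs hz) f) (ht : t ∈ J) :
    HasDerivWithinAt ψ (ev (pt ht hz) ((calculus hJ hJ' hU).dt f)) J t := by
  have h1 : HasFDerivWithinAt (lift f) (fderivWithin ℝ (lift f) (J ×ˢ U) (t, z)) (J ×ˢ U) (t, z) :=
    (differentiableWithinAt_lift f (pt ht hz)).hasFDerivWithinAt
  have h2 : HasDerivWithinAt (fun s : ℝ => (s, z)) ((1 : ℝ), (0 : Cn n)) J t :=
    (hasDerivWithinAt_id t J).prodMk (hasDerivWithinAt_const t J z)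
  have h3 := h1.comp_hasDerivWithinAt t h2 fun s hs => Set.mk_mem_prod hs hz
  exact h3.congr (fun s hs => (hψ s hs).trans (lift_apply f (pt hs hz)).symm)
    ((hψ t ht).trans (lift_apply f (pt ht hz)).symm)

/-- The time derivative is determined by its values along fixed points. -/
theorem dt_eq {f f' : smoothRing (J ×ˢ U)}
    (h : ∀ t (ht : t ∈ J) z (hz : z ∈ U), ∃ ψ : ℝ → ℂ,
      (∀ s (hs : s ∈ J), ψ s = ev (pt hs hz) f) ∧
        HasDerivWithinAt ψ (ev (pt ht hz) f') J t) :
    (calculus hJ hJ' hU).dt f = f' := by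
  refine ext_ev ?_
  rintro ⟨⟨t, z⟩, ht, hz⟩
  obtain ⟨ψ, h1, h2⟩ := h t ht z hz
  exact (uniqueDiffOn_time hJ hJ' t ht).eq_deriv _
    (hasDerivWithinAt_ev hJ hJ' hU f hz h1 ht) h2

theorem IsMatSlice.apply {ι : Type} {h : Cn n → Matrix ι ι ℂ}
    {H : Matrix ι ι (smoothRing (J ×ˢ U))} (hh : IsMatSlice ht h H) (A B : ι) :
    IsSlice ht (fun w => h w A B) (H A B) := fun w hw =>
  congrFun (congrFun (hh w hw) A) B

theorem IsMatSlice.inv {ι : Type} [Fintype ι] [DecidableEq ι] {h : Cn n → Matrix ι ι ℂ}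
    {H Hi : Matrix ι ι (smoothRing (J ×ˢ U))} (hh : IsMatSlice ht h H) (hi : H * Hi = 1) :
    IsMatSlice ht (fun w => (h w)⁻¹) Hi := fun w hw => by
  refine Matrix.inv_eq_right_inv ?_
  rw [hh w hw, ← Matrix.map_mul, hi]
  exact Matrix.map_one _ (map_zero _) (map_one _)

end smoothRing

/-! ## Translation of the tensors -/

theorem tracePairing_eq_sum {R : Type*} [CommRing R] [StarRing R] {n : ℕ} {ι : Type} [Fintype ι]
    (gi : Matrix (Fin n) (Fin n) R) (h hi : Matrix ι ι R) (Φ Ψ : Fin n → Matrix ι ι R) :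
    tracePairing gi h hi Φ Ψ = ∑ i, ∑ j, ∑ A, ∑ B, ∑ C, ∑ D,
      gi j i * hi C A * h B D * Φ i A B * star (Ψ j C D) := by
  refine Finset.sum_congr rfl fun i _ => Finset.sum_congr rfl fun j _ => ?_
  simp only [Matrix.trace, Matrix.diag_apply, Matrix.mul_apply, Matrix.conjTranspose_apply,
    Finset.mul_sum, Finset.sum_mul]
  have e : ∀ F : ι → ι → ι → ι → R,
      ∑ C, ∑ D, ∑ B, ∑ A, F A B C D = ∑ A, ∑ B, ∑ C, ∑ D, F A B C D := by
    intro F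
    calc _ = ∑ x : ι × ι × ι × ι, F x.2.2.2 x.2.2.1 x.1 x.2.1 := by
          simp only [Fintype.sum_prod_type]
      _ = ∑ y : ι × ι × ι × ι, F y.1 y.2.1 y.2.2.1 y.2.2.2 :=
          Fintype.sum_equiv ⟨fun x => (x.2.2.2, x.2.2.1, x.1, x.2.1),
            fun y => (y.2.2.1, y.2.2.2, y.2.1, y.1), fun _ => rfl, fun _ => rfl⟩ _ _ fun _ => rfl
      _ = _ := by simp only [Fintype.sum_prod_type]
  rw [e]
  exact Finset.sum_congr rfl fun A _ => Finset.sum_congr rfl fun B _ =>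
    Finset.sum_congr rfl fun C _ => Finset.sum_congr rfl fun D _ => by ring

namespace smoothRing

variable {n : ℕ} {J : Set ℝ} {U : Set (Cn n)}
  (hJ : J.OrdConnected) (hJ' : J.Nontrivial) (hU : IsOpen U) {t : ℝ} {ht : t ∈ J}
  {ι : Type} [Fintype ι] [DecidableEq ι]

/-- `Φc` is on `U` the time slice of `Φ` at `t`, for sections of `Λ^{1,0} ⊗ End`. -/
def IsSecSlice (ht : t ∈ J) (Φc : Fin n → ι → ι → Cn n → ℂ)
    (Φ : Fin n → Matrix ι ι (smoothRing (J ×ˢ U))) : Prop :=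
  ∀ i A B, IsSlice ht (Φc i A B) (Φ i A B)

variable {g : Cn n → Matrix (Fin n) (Fin n) ℂ} {G Gi : Matrix (Fin n) (Fin n) (smoothRing (J ×ˢ U))}
  {h : Cn n → Matrix ι ι ℂ} {H Hi : Matrix ι ι (smoothRing (J ×ˢ U))}

theorem isSecSlice_chern (hh : IsMatSlice ht h H) (hH : H * Hi = 1) :
    IsSecSlice ht (chern h) ((calculus hJ hJ' hU).chernMat H Hi) := by
  intro i A B w hw
  simp only [chern, WirtingerCalculus.chernMat, Matrix.mul_apply, map_sum, map_mul,
    (hh.inv hH).apply _ _ w hw, Matrix.map_apply]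
  exact Finset.sum_congr rfl fun C _ => by
    rw [((hh.apply A C).dz hJ hJ' hU i) w hw]

theorem IsSecSlice.nabla (hg : IsMatSlice ht g G) (hG : G * Gi = 1) (hh : IsMatSlice ht h H)
    (hH : H * Hi = 1) {Φc : Fin n → ι → ι → Cn n → ℂ}
    {Φ : Fin n → Matrix ι ι (smoothRing (J ×ˢ U))} (hΦ : IsSecSlice ht Φc Φ) (l : Fin n) :
    IsSecSlice ht (nabla g h l Φc) ((calculus hJ hJ' hU).cov G Gi H Hi l Φ) := by
  intro i A B w hw
  have h1 := isSecSlice_chern hJ hJ' hU hg hG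
  have h2 := isSecSlice_chern hJ hJ' hU hh hH
  simp only [PCF.nabla, WirtingerCalculus.cov, covDeriv, Matrix.add_apply, Matrix.sub_apply,
    Matrix.map_apply, Matrix.mul_apply, Matrix.sum_apply, Matrix.smul_apply, smul_eq_mul, map_add,
    map_sub, map_sum, map_mul, (hΦ _ _ _) w hw, h1 _ _ _ w hw, h2 _ _ _ w hw,
    ((hΦ i A B).dz hJ hJ' hU l) w hw]
  congr 1
  exact Finset.sum_congr rfl fun C _ => mul_comm _ _

omit [Fintype ι] [DecidableEq ι] in
theorem IsSecSlice.nablaBar {Φc : Fin n → ι → ι → Cn n → ℂ}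
    {Φ : Fin n → Matrix ι ι (smoothRing (J ×ˢ U))} (hΦ : IsSecSlice ht Φc Φ) (k : Fin n) :
    IsSecSlice ht (nablaBar k Φc) (fun i => (Φ i).map ((calculus hJ hJ' hU).db k)) :=
  fun i A B => (hΦ i A B).dzbar hJ hJ' hU k

theorem isSecSlice_chernCurv (hh : IsMatSlice ht h H) (hH : H * Hi = 1) (k : Fin n) :
    IsSecSlice ht (fun i A B => chernCurv h i k A B)
      ((calculus hJ hJ' hU).curvMat H Hi k) := by
  intro i A B w hw
  simp only [chernCurv, WirtingerCalculus.curvMat, Matrix.neg_apply, map_neg, Matrix.map_apply]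
  exact congrArg Neg.neg (((isSecSlice_chern hJ hJ' hU hh hH) i A B).dzbar hJ hJ' hU k w hw)

theorem isSlice_pairing (hg : IsMatSlice ht g G) (hG : G * Gi = 1) (hh : IsMatSlice ht h H)
    (hH : H * Hi = 1) {Φc Ψc : Fin n → ι → ι → Cn n → ℂ}
    {Φ Ψ : Fin n → Matrix ι ι (smoothRing (J ×ˢ U))} (hΦ : IsSecSlice ht Φc Φ)
    (hΨ : IsSecSlice ht Ψc Ψ) :
    IsSlice ht (fun w => pairing (g w) (h w) (fun i A B => Φc i A B w) (fun i A B => Ψc i A B w))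
      (tracePairing Gi H Hi Φ Ψ) := by
  intro w hw
  simp only [pairing, tracePairing_eq_sum, map_sum, map_mul, ev_star, (hg.inv hG).apply _ _ w hw,
    (hh.inv hH).apply _ _ w hw, hh.apply _ _ w hw, hΦ _ _ _ w hw, hΨ _ _ _ w hw]

theorem isSlice_torsion (hg : IsMatSlice ht g G) (hG : G * Gi = 1) (i j k : Fin n) :
    IsSlice ht (torsion g i j k) ((calculus hJ hJ' hU).tors G Gi i j k) := by
  intro w hw
  have h1 := isSecSlice_chern hJ hJ' hU hg hG
  rw [torsion, WirtingerCalculus.tors, map_sub, h1 i j k w hw, h1 j i k w hw]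

theorem isSlice_torsionLow (hg : IsMatSlice ht g G) (hG : G * Gi = 1) (i j k : Fin n) :
    IsSlice ht (torsionLow g i j k) ((calculus hJ hJ' hU).torsLow G i j k) := by
  intro w hw
  have h1 := isSlice_torsion hJ hJ' hU hg hG
  simp only [torsionLow, ← WirtingerCalculus.tors_mul _ hG, map_sum, map_mul, h1 _ _ _ w hw,
    hg.apply _ _ w hw]

theorem isSlice_laplacian (hg : IsMatSlice ht g G) (hG : G * Gi = 1) {φ : Cn n → ℂ}
    {f : smoothRing (J ×ˢ U)} (hφ : IsSlice ht φ f) :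
    IsSlice ht (laplacian g φ)
      (∑ k, ∑ l, Gi k l * (calculus hJ hJ' hU).d l ((calculus hJ hJ' hU).db k f)) := by
  intro w hw
  simp only [laplacian, map_sum, map_mul, (hg.inv hG).apply _ _ w hw]
  exact Finset.sum_congr rfl fun k _ => Finset.sum_congr rfl fun l _ => by
    rw [← ((hφ.dzbar hJ hJ' hU k).dz hJ hJ' hU l) w hw]

section Background

variable {g' : Cn n → Matrix (Fin n) (Fin n) ℂ}
  {G' Gi' : Matrix (Fin n) (Fin n) (smoothRing (J ×ˢ U))}
  {h' : Cn n → Matrix ι ι ℂ} {H' Hi' : Matrix ι ι (smoothRing (J ×ˢ U))}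

theorem isSecSlice_upsilon (hh : IsMatSlice ht h H) (hH : H * Hi = 1) (hh' : IsMatSlice ht h' H')
    (hH' : H' * Hi' = 1) :
    IsSecSlice ht (upsilon h h') (fun i => (calculus hJ hJ' hU).chernMat H Hi i
      - (calculus hJ hJ' hU).chernMat H' Hi' i) := by
  intro i A B w hw
  simp only [upsilon, Matrix.sub_apply, map_sub]
  rw [isSecSlice_chern hJ hJ' hU hh hH i A B w hw,
    isSecSlice_chern hJ hJ' hU hh' hH' i A B w hw]

theorem isSecSlice_torsionDot (hg : IsMatSlice ht g G) (hG : G * Gi = 1)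
    {Υ : Fin n → Matrix ι ι (smoothRing (J ×ˢ U))} (hΥ : IsSecSlice ht (upsilon h h') Υ)
    (k : Fin n) :
    IsSecSlice ht (torsionDot g h h' k) ((calculus hJ hJ' hU).torsMul G Gi Υ k) := by
  intro i A B w hw
  simp only [torsionDot, WirtingerCalculus.torsMul, Matrix.sum_apply, Matrix.smul_apply,
    smul_eq_mul, map_sum, map_mul, ev_star, (hg.inv hG).apply _ _ w hw, hΥ _ _ _ w hw,
    isSlice_torsionLow hJ hJ' hU hg hG _ _ _ w hw]

theorem isSecSlice_torsionCurv (hg : IsMatSlice ht g G) (hG : G * Gi = 1)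
    (hh' : IsMatSlice ht h' H') (hH' : H' * Hi' = 1) :
    IsSecSlice ht (torsionCurv g h') (fun i => ∑ k, ∑ l, Gi k l •
      ∑ p, (calculus hJ hJ' hU).tors G Gi i l p • (calculus hJ hJ' hU).curvMat H' Hi' k p) := by
  intro i A B w hw
  have h1 := fun k => isSecSlice_chernCurv hJ hJ' hU hh' hH' k
  have h2 := fun k p A B => h1 k p A B w hw
  simp only [torsionCurv, Matrix.sum_apply, Matrix.smul_apply, smul_eq_mul, map_sum, map_mul,
    (hg.inv hG).apply _ _ w hw, h2, isSlice_torsion hJ hJ' hU hg hG _ _ _ w hw, Finset.mul_sum,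
    mul_assoc]

theorem isSecSlice_upsilonCurv (hg : IsMatSlice ht g G) (hG : G * Gi = 1)
    (hg' : IsMatSlice ht g' G') (hG' : G' * Gi' = 1) (hh' : IsMatSlice ht h' H')
    (hH' : H' * Hi' = 1) {Υ : Fin n → Matrix ι ι (smoothRing (J ×ˢ U))}
    (hΥ : IsSecSlice ht (upsilon h h') Υ) :
    IsSecSlice ht (upsilonCurv g g' h h') (fun i => ∑ k, ∑ l, Gi k l •
      (∑ p, ((calculus hJ hJ' hU).chernMat G Gi l - (calculus hJ hJ' hU).chernMat G' Gi' l) i p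
        • (calculus hJ hJ' hU).curvMat H' Hi' k p
        + Υ l * (calculus hJ hJ' hU).curvMat H' Hi' k i
        - (calculus hJ hJ' hU).curvMat H' Hi' k i * Υ l)) := by
  intro i A B w hw
  have h1 := fun k => isSecSlice_chernCurv hJ hJ' hU hh' hH' k
  have h2 := fun k p A B => h1 k p A B w hw
  have h3 := isSecSlice_upsilon hJ hJ' hU hg hG hg' hG'
  simp only [upsilonCurv, Matrix.sum_apply, Matrix.smul_apply, Matrix.add_apply, Matrix.sub_apply,
    Matrix.mul_apply, smul_eq_mul, map_sum, map_mul, map_add, map_sub,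
    (hg.inv hG).apply _ _ w hw, h2, h3 _ _ _ w hw, hΥ _ _ _ w hw]
  simp only [mul_comm (ev _ (WirtingerCalculus.curvMat _ _ _ _ _ _ _))]

theorem isSecSlice_gradCurv (hg : IsMatSlice ht g G) (hG : G * Gi = 1)
    (hg' : IsMatSlice ht g' G') (hG' : G' * Gi' = 1) (hh' : IsMatSlice ht h' H')
    (hH' : H' * Hi' = 1) :
    IsSecSlice ht (gradCurv g g' h') (fun i => ∑ k, ∑ l, Gi k l •
      (calculus hJ hJ' hU).cov G' Gi' H' Hi' l ((calculus hJ hJ' hU).curvMat H' Hi' k) i) := by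
  intro i A B w hw
  have h1 := fun k l => (isSecSlice_chernCurv hJ hJ' hU hh' hH' k).nabla hJ hJ' hU hg' hG' hh' hH' l
  have h2 := fun k l => h1 k l i A B w hw
  simp only [gradCurv, Matrix.sum_apply, Matrix.smul_apply, smul_eq_mul, map_sum, map_mul,
    (hg.inv hG).apply _ _ w hw, h2]

end Background

end smoothRing

/-- The curvature of the background connection, differentiated with the Chern connections of `g`
and `h`, in terms of its derivative with respect to background connections. -/
theorem WirtingerCalculus.error_decomposition {R : Type*} [CommRing R] [StarRing R] [Algebra ℂ R]
    {n : ℕ} {ι : Type} [Fintype ι] [DecidableEq ι] (W : WirtingerCalculus n R)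
    (G Gi G' Gi' : Matrix (Fin n) (Fin n) R) (H Hi H' Hi' : Matrix ι ι R)
    (i : Fin n) :
    ∑ k, ∑ l, Gi k l • (W.cov G Gi H Hi l (fun p => (W.chernMat H' Hi' p).map (W.db k)) i
        + ∑ p, W.tors G Gi l i p • (W.chernMat H' Hi' p).map (W.db k))
      = ∑ k, ∑ l, Gi k l • ∑ p, W.tors G Gi i l p • W.curvMat H' Hi' k p
        + ∑ k, ∑ l, Gi k l • (
          ∑ p, (W.chernMat G Gi l - W.chernMat G' Gi' l) i p • W.curvMat H' Hi' k p
          + (W.chernMat H Hi l - W.chernMat H' Hi' l) * W.curvMat H' Hi' k i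
          - W.curvMat H' Hi' k i * (W.chernMat H Hi l - W.chernMat H' Hi' l))
        - ∑ k, ∑ l, Gi k l • W.cov G' Gi' H' Hi' l (W.curvMat H' Hi' k) i := by
  rw [← Finset.sum_add_distrib, ← Finset.sum_sub_distrib]
  refine Finset.sum_congr rfl fun k _ => ?_
  rw [← Finset.sum_add_distrib, ← Finset.sum_sub_distrib]
  refine Finset.sum_congr rfl fun l _ => ?_
  rw [← smul_add, ← smul_sub]
  congr 1
  -- What remains is `∇ - ∇̃` acting through the differences of connection matrices, together with
  -- `∂̄Γ' = -Ω̃` and the skew symmetry of the torsion.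
  have e : ∀ p, W.tors G Gi i l p = -W.tors G Gi l i p := fun p => (neg_sub _ _).symm
  simp only [cov, covDeriv, curvMat, e, Matrix.sub_apply, sub_smul, neg_smul, smul_neg, neg_neg, mul_neg,
    neg_mul, sub_mul, mul_sub, Finset.sum_sub_distrib, Finset.sum_neg_distrib, derivation_map_neg]
  abel

/-- The evolution of `|Υ|²` with the curvature terms expressed through background derivatives. -/
theorem WirtingerCalculus.evolution_upsilon {R : Type*} [CommRing R] [StarRing R] [Algebra ℂ R]
    {n : ℕ} {ι : Type} [Fintype ι] [DecidableEq ι] (W : WirtingerCalculus n R)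
    {G Gi : Matrix (Fin n) (Fin n) R} (G' Gi' : Matrix (Fin n) (Fin n) R) {H Hi H' Hi' : Matrix ι ι R}
    (hG : G * Gi = 1) (hH : H * Hi = 1) (hGi : Gi.IsHermitian) (hHH : H.IsHermitian)
    (hHi : Hi.IsHermitian) (hflow : H.map W.dt = W.curvTrace Gi H Hi)
    (gflow : G.map W.dt = W.curvTrace Gi G Gi + W.torsSq G Gi)
    (hΓ' : ∀ i, (W.chernMat H' Hi' i).map W.dt = 0) {Υ : Fin n → Matrix ι ι R}
    (hΥ : ∀ i, Υ i = W.chernMat H Hi i - W.chernMat H' Hi' i) {F₁ F₂ F₃ : Fin n → Matrix ι ι R}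
    (h₁ : ∀ i, F₁ i = ∑ k, ∑ l, Gi k l • ∑ p, W.tors G Gi i l p • W.curvMat H' Hi' k p)
    (h₂ : ∀ i, F₂ i = ∑ k, ∑ l, Gi k l • (
      ∑ p, (W.chernMat G Gi l - W.chernMat G' Gi' l) i p • W.curvMat H' Hi' k p
        + Υ l * W.curvMat H' Hi' k i - W.curvMat H' Hi' k i * Υ l))
    (h₃ : ∀ i, F₃ i = ∑ k, ∑ l, Gi k l • W.cov G' Gi' H' Hi' l (W.curvMat H' Hi' k) i) :
    W.dt (tracePairing Gi H Hi Υ Υ)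
      = ∑ k, ∑ l, Gi k l * W.d l (W.db k (tracePairing Gi H Hi Υ Υ))
        - ∑ l, ∑ m, Gi m l *
            tracePairing Gi H Hi (W.cov G Gi H Hi l Υ) (W.cov G Gi H Hi m Υ)
        - ∑ k, ∑ m, Gi k m * tracePairing Gi H Hi
            (fun i => (Υ i).map (W.db k) + W.torsMul G Gi Υ k i)
            (fun i => (Υ i).map (W.db m) + W.torsMul G Gi Υ m i)
        + (tracePairing Gi H Hi F₁ Υ + star (tracePairing Gi H Hi F₁ Υ))
        + (tracePairing Gi H Hi F₂ Υ + star (tracePairing Gi H Hi F₂ Υ))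
        - (tracePairing Gi H Hi F₃ Υ + star (tracePairing Gi H Hi F₃ Υ)) := by
  rw [W.evolution_tracePairing hG hH hGi hHH hHi hflow gflow _ hΓ' Υ (fun i => F₁ i + F₂ i - F₃ i) hΥ
    fun i => by
      rw [h₁, h₂, h₃, W.error_decomposition G Gi G' Gi']
      simp only [hΥ],
    tracePairing_sub_left, tracePairing_add_left, star_sub, star_add]
  ring

/-! ### Matrices of smooth functions, and the Bismut-Ricci form as a time slice -/

namespace smoothRing

variable {n : ℕ} {J : Set ℝ} {U : Set (Cn n)}

/-- The elements of the ring given by a matrix of smooth functions. -/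
def ofFun {α β : Type*} (F : ℝ × Cn n → Matrix α β ℂ)
    (hF : ∀ i j, ContDiffOn ℝ ∞ (fun p => F p i j) (J ×ˢ U)) :
    Matrix α β (smoothRing (J ×ˢ U)) :=
  Matrix.of fun i j => ⟨fun p => F p i j, fun p => F p i j, hF i j, fun _ => rfl⟩

theorem isUnit_det {ι : Type} [Fintype ι] [DecidableEq ι]
    {H : Matrix ι ι (smoothRing (J ×ˢ U))} (hH : ∀ p, (H.map (ev p)).det ≠ 0) : IsUnit H.det :=
  isUnit_of_ev_ne_zero _ fun p => by
    have := hH p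
    rwa [← AlgHom.mapMatrix_apply, ← AlgHom.map_det] at this

theorem isHermitian_of_ev {ι : Type} {H : Matrix ι ι (smoothRing (J ×ˢ U))}
    (hH : ∀ p, (H.map (ev p)).IsHermitian) : H.IsHermitian := by
  ext i j : 1
  exact ext_ev fun p => (hH p).apply i j

variable (hJ : J.OrdConnected) (hJ' : J.Nontrivial) (hU : IsOpen U) {t : ℝ} {ht : t ∈ J}

section GenMetric

variable {g b : Cn n → Matrix (Fin n) (Fin n) ℂ}
  {G Gi B : Matrix (Fin n) (Fin n) (smoothRing (J ×ˢ U))}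

theorem isMatSlice_genMetric (hg : IsMatSlice ht g G) (hG : G * Gi = 1) (hb : IsMatSlice ht b B) :
    IsMatSlice ht (genMetric g b) (WirtingerCalculus.genMat G Gi B) := by
  intro w hw
  ext i j
  rcases i with i | i <;> rcases j with j | j
  · simp only [genMetric, WirtingerCalculus.genMat, Matrix.map_apply, Matrix.fromBlocks_apply₁₁,
      Matrix.of_apply, Matrix.add_apply, Matrix.mul_apply, Matrix.transpose_apply,
      Matrix.conjTranspose_apply, map_add, map_sum, map_mul, ev_star, Finset.sum_mul,
      hg.apply _ _ w hw, hb.apply _ _ w hw, (hg.inv hG).apply _ _ w hw]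
    rw [Finset.sum_comm]
    exact congrArg _ (Finset.sum_congr rfl fun k _ => Finset.sum_congr rfl fun l _ => by ring)
  · simp only [genMetric, WirtingerCalculus.genMat, Matrix.map_apply, Matrix.fromBlocks_apply₁₂,
      Matrix.of_apply, Matrix.mul_apply, Matrix.transpose_apply, map_sum, map_mul,
      hb.apply _ _ w hw, (hg.inv hG).apply _ _ w hw]
    exact Finset.sum_congr rfl fun p _ => mul_comm _ _
  · simp only [genMetric, WirtingerCalculus.genMat, Matrix.map_apply, Matrix.fromBlocks_apply₂₁,
      Matrix.of_apply, Matrix.mul_apply, Matrix.transpose_apply, Matrix.conjTranspose_apply,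
      map_sum, map_mul, ev_star, hb.apply _ _ w hw, (hg.inv hG).apply _ _ w hw]
  · simp only [genMetric, WirtingerCalculus.genMat, Matrix.map_apply, Matrix.fromBlocks_apply₂₂,
      Matrix.of_apply, Matrix.transpose_apply, (hg.inv hG).apply _ _ w hw]

theorem isSlice_bismutHol (hg : IsMatSlice ht g G) (hG : G * Gi = 1) (i j k : Fin n) :
    IsSlice ht (bismutHol g i j k)
      (∑ l, (calculus hJ hJ' hU).d j (G i l) * Gi l k) := by
  intro w hw
  simp only [bismutHol, map_sum, map_mul, (hg.inv hG).apply _ _ w hw,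
    ((hg.apply _ _).dz hJ hJ' hU j) w hw]

theorem isSlice_bismutAnti (hg : IsMatSlice ht g G) (hG : G * Gi = 1) (i j k : Fin n) :
    IsSlice ht (bismutAnti g i j k)
      (∑ l, ((calculus hJ hJ' hU).db i (G j l) - (calculus hJ hJ' hU).db l (G j i)) * Gi l k) := by
  intro w hw
  simp only [bismutAnti, map_sum, map_mul, map_sub, (hg.inv hG).apply _ _ w hw,
    ((hg.apply _ _).dzbar hJ hJ' hU _) w hw]

/-- Commutators are traceless, so only derivatives of the traced Bismut coefficients survive in the
Bismut-Ricci form. -/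
theorem sum_commutator (X Y : Fin n → Fin n → ℂ) :
    ∑ a, ∑ c, (X a c * Y c a - Y a c * X c a) = 0 := by
  simp only [Finset.sum_sub_distrib]
  rw [Finset.sum_comm, sub_eq_zero]
  exact Finset.sum_congr rfl fun a _ => Finset.sum_congr rfl fun c _ => mul_comm _ _

theorem isSlice_rhoB11 (hg : IsMatSlice ht g G) (hG : G * Gi = 1) (i j : Fin n) :
    IsSlice ht (rhoB11 g i j) (Complex.I • ∑ a, (
      (calculus hJ hJ' hU).d i
        (∑ l, ((calculus hJ hJ' hU).db j (G a l) - (calculus hJ hJ' hU).db l (G a j)) * Gi l a) -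
      (calculus hJ hJ' hU).db j (∑ l, (calculus hJ hJ' hU).d a (G i l) * Gi l a))) := by
  intro w hw
  simp only [rhoB11, bismutCurv11, Finset.sum_add_distrib,
    sum_commutator (fun a c => bismutAnti g j a c w) (fun a c => bismutHol g i a c w), add_zero]
  rw [map_smul, smul_eq_mul, map_sum]
  refine congrArg _ (Finset.sum_congr rfl fun a _ => ?_)
  rw [map_sub, ← (isSlice_bismutAnti hJ hJ' hU hg hG j a a).dz hJ hJ' hU i w hw,
    ← (isSlice_bismutHol hJ hJ' hU hg hG i a a).dzbar hJ hJ' hU j w hw]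

theorem isSlice_rhoB20 (hg : IsMatSlice ht g G) (hG : G * Gi = 1) (i j : Fin n) :
    IsSlice ht (rhoB20 g i j) (Complex.I • ∑ a, (
      (calculus hJ hJ' hU).d i (∑ l, (calculus hJ hJ' hU).d a (G j l) * Gi l a) -
      (calculus hJ hJ' hU).d j (∑ l, (calculus hJ hJ' hU).d a (G i l) * Gi l a))) := by
  intro w hw
  simp only [rhoB20, bismutCurv20, Finset.sum_add_distrib,
    sum_commutator (fun a c => bismutHol g j a c w) (fun a c => bismutHol g i a c w), add_zero]
  rw [map_smul, smul_eq_mul, map_sum]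
  refine congrArg _ (Finset.sum_congr rfl fun a _ => ?_)
  rw [map_sub, ← (isSlice_bismutHol hJ hJ' hU hg hG j a a).dz hJ hJ' hU i w hw,
    ← (isSlice_bismutHol hJ hJ' hU hg hG i a a).dz hJ hJ' hU j w hw]

end GenMetric

end smoothRing

/-! ## Components of metrics in charts -/

section Chart

variable {n : ℕ} {M : Type*} [TopologicalSpace M] [ChartedSpace (Cn n) M]
  {e : OpenPartialHomeomorph M (Cn n)} {z : Cn n}

theorem HermitianMetric.comp_isHermitian (g : HermitianMetric n M) :
    (g.comp e z).IsHermitian := by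
  ext i j
  exact (g.symm _ _ _).symm

theorem TwoZeroForm.comp_transpose (b : TwoZeroForm n M) :
    (b.comp e z).transpose = -b.comp e z := by
  ext i j
  have h := b.alt (e.symm z) (coordVec e z i + coordVec e z j)
  simp only [map_add, LinearMap.add_apply, b.alt, zero_add, add_zero] at h
  exact eq_neg_of_add_eq_zero_left h

theorem mfderiv_symm_injective (he : e ∈ holCharts n M) (hz : z ∈ e.target) :
    Function.Injective (mfderiv 𝓘(ℂ, Cn n) 𝓘(ℂ, Cn n) e.symm z) := by
  have he' : e.MDifferentiable 𝓘(ℂ, Cn n) 𝓘(ℂ, Cn n) :=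
    ⟨(contMDiffOn_of_mem_maximalAtlas he).mdifferentiableOn (by simp),
      (contMDiffOn_symm_of_mem_maximalAtlas he).mdifferentiableOn (by simp)⟩
  have h := he'.comp_symm_deriv hz
  exact Function.LeftInverse.injective fun v => congrArg (fun L => L v) h

/-- A null vector of the component matrix would map, under the injective differential of the inverse
chart, to a nonzero tangent vector of length zero. -/
theorem HermitianMetric.comp_det_ne_zero (g : HermitianMetric n M) (he : e ∈ holCharts n M)
    (hz : z ∈ e.target) : (g.comp e z).det ≠ 0 := by
  intro h
  obtain ⟨v, hv, hv0⟩ := Matrix.exists_vecMul_eq_zero_iff.mpr h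
  obtain ⟨V, hV⟩ : ∃ V, V = mfderiv 𝓘(ℂ, Cn n) 𝓘(ℂ, Cn n) e.symm z v := ⟨_, rfl⟩
  have hV0 : V ≠ 0 := fun h0 => hv (mfderiv_symm_injective he hz (by
    rw [← hV, h0]; exact (map_zero _).symm))
  have hVs : V = ∑ i, v i • coordVec e z i := by
    have hvs : v = ∑ i, v i • (Pi.single i (1 : ℂ) : Cn n) := by
      ext j
      simp [Finset.sum_apply, Pi.single_apply]
    rw [hV]
    conv_lhs => rw [hvs]
    exact (map_sum _ _ _).trans (Finset.sum_congr rfl fun i _ => map_smul _ _ _)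
  have h1 : ∀ j, g.form (e.symm z) V (coordVec e z j) = 0 := fun j => by
    have := congrFun hv0 j
    rw [hVs, map_sum, LinearMap.sum_apply]
    simp only [map_smul, LinearMap.smul_apply]
    exact this
  have h2 : g.form (e.symm z) V V = 0 := by
    calc g.form (e.symm z) V V = g.form (e.symm z) V (∑ i, v i • coordVec e z i) :=
          congrArg _ hVs
      _ = 0 := by
          rw [map_sum]
          exact Finset.sum_eq_zero fun j _ => by rw [LinearMap.map_smulₛₗ, h1, smul_zero]
  have := g.pos _ V hV0
  rw [h2] at this
  simp at this

end Chart

open smoothRing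

/-! ### The flow equations of a chart, read in the ring -/

section Flow

variable {n : ℕ} {M : Type*} [TopologicalSpace M] [ChartedSpace (Cn n) M] {J : Set ℝ}
  {g : ℝ → HermitianMetric n M} {b : ℝ → TwoZeroForm n M}
  {e : OpenPartialHomeomorph M (Cn n)}

/-- The metrics of a pluriclosed flow, as a matrix over the ring of smooth functions. -/
def IsPluriclosedFlow.metricMat (hflow : IsPluriclosedFlow J g b) (he : e ∈ holCharts n M) :
    Matrix (Fin n) (Fin n) (smoothRing (J ×ˢ e.target)) :=
  ofFun (fun p => (g p.1).comp e p.2) (hflow.smooth_metric e he)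

/-- The potentials of a pluriclosed flow, as a matrix over the ring of smooth functions. -/
def IsPluriclosedFlow.potentialMat (hflow : IsPluriclosedFlow J g b) (he : e ∈ holCharts n M) :
    Matrix (Fin n) (Fin n) (smoothRing (J ×ˢ e.target)) :=
  ofFun (fun p => (b p.1).comp e p.2) (hflow.smooth_potential e he)

/-- A stationary metric, as a matrix over the ring of smooth functions. -/
def HermitianMetric.constMat (g : HermitianMetric n M) (J : Set ℝ) (he : e ∈ holCharts n M) :
    Matrix (Fin n) (Fin n) (smoothRing (J ×ˢ e.target)) :=
  ofFun (fun p => g.comp e p.2) fun i j =>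
    (g.smooth e he i j).comp contDiffOn_snd fun _ hp => hp.2

/-- A stationary `(2,0)`-form, as a matrix over the ring of smooth functions. -/
def TwoZeroForm.constMat (b : TwoZeroForm n M) (J : Set ℝ) (he : e ∈ holCharts n M) :
    Matrix (Fin n) (Fin n) (smoothRing (J ×ˢ e.target)) :=
  ofFun (fun p => b.comp e p.2) fun i j =>
    (b.smooth e he i j).comp contDiffOn_snd fun _ hp => hp.2

theorem HermitianMetric.constMat_mul_inv (g : HermitianMetric n M) (J : Set ℝ)
    (he : e ∈ holCharts n M) : g.constMat J he * (g.constMat J he)⁻¹ = 1 :=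
  Matrix.mul_nonsing_inv _ (isUnit_det fun p => g.comp_det_ne_zero he p.2.2)

theorem IsPluriclosedFlow.metricMat_mul_inv (hflow : IsPluriclosedFlow J g b)
    (he : e ∈ holCharts n M) : hflow.metricMat he * (hflow.metricMat he)⁻¹ = 1 :=
  Matrix.mul_nonsing_inv _ (isUnit_det fun p => (g p.1.1).comp_det_ne_zero he p.2.2)

theorem IsPluriclosedFlow.isFlow (hflow : IsPluriclosedFlow J g b) (hJ : J.OrdConnected)
    (hJ' : J.Nontrivial) (he : e ∈ holCharts n M) :
    (calculus hJ hJ' e.open_target).IsFlow (hflow.metricMat he) (hflow.metricMat he)⁻¹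
      (hflow.potentialMat he) := by
  have hG := hflow.metricMat_mul_inv he
  have sg : ∀ t (ht : t ∈ J), IsMatSlice ht ((g t).comp e) (hflow.metricMat he) :=
    fun t ht w hw => rfl
  have sb : ∀ t (ht : t ∈ J), IsMatSlice ht ((b t).comp e) (hflow.potentialMat he) :=
    fun t ht w hw => rfl
  have sω : ∀ t (ht : t ∈ J) i j, IsSlice ht (fundForm ((g t).comp e) i j)
      (Complex.I • hflow.metricMat he i j) := fun t ht i j w hw => by
    rw [map_smul]; rfl
  refine ⟨hG, isHermitian_of_ev fun p => (g p.1.1).comp_isHermitian, ?_, fun i j k => ?_,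
    fun i j => ?_, fun i j => ?_⟩
  · ext i j : 1
    exact ext_ev fun p => congrFun (congrFun (b p.1.1).comp_transpose i) j
  · refine ext_ev ?_
    rintro ⟨⟨t, z⟩, ht, hz⟩
    have h := hflow.torsion_potential e he t ht z hz i j k
    rw [(sω t ht j k).dz hJ hJ' e.open_target i z hz, (sω t ht i k).dz hJ hJ' e.open_target j z hz,
      ((sb t ht).apply i j).dzbar hJ hJ' e.open_target k z hz, Derivation.map_smul,
      Derivation.map_smul, ← map_sub, ← smul_sub] at h
    rw [map_neg]
    exact eq_neg_of_add_eq_zero_right h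
  · refine dt_eq hJ hJ' e.open_target fun t ht z hz =>
      ⟨fun s => (g s).comp e z i j, fun s hs => rfl, ?_⟩
    -- The flow is stated for `ω = √-1 g`; the factor `-√-1` recovers the equation for `g`.
    have h := (hflow.metric_evolution e he t ht z hz i j).const_mul (-Complex.I)
    rw [isSlice_rhoB11 hJ hJ' e.open_target (sg t ht) hG i j z hz] at h
    simp only [fundForm, ← mul_assoc, neg_mul, Complex.I_mul_I, neg_neg, one_mul, map_smul,
      smul_eq_mul, mul_neg] at h
    rwa [map_neg]
  · refine dt_eq hJ hJ' e.open_target fun t ht z hz =>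
      ⟨fun s => (b s).comp e z i j, fun s hs => rfl, ?_⟩
    have h := hflow.potential_evolution e he t ht z hz i j
    rw [isSlice_rhoB20 hJ hJ' e.open_target (sg t ht) hG i j z hz] at h
    rwa [map_neg]

end Flow

/-! ### Evaluation of the algebraic identity at a point -/

namespace smoothRing

variable {n : ℕ} {J : Set ℝ} {U : Set (Cn n)} {ι : Type} [Fintype ι] [DecidableEq ι]

/-- The evolution of `|Υ|²` on `J × U`, when `∂_t h = -g^{k̄ l} Ω_{l k̄}` and `∂_t g = -S + Q`. -/
theorem hasDerivWithinAt_upsilonNormSq (hJ : J.OrdConnected) (hJ' : J.Nontrivial) (hU : IsOpen U)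
    {W : WirtingerCalculus n (smoothRing (J ×ˢ U))} (hW : W = calculus hJ hJ' hU)
    {G Gi G' Gi' : Matrix (Fin n) (Fin n) (smoothRing (J ×ˢ U))}
    {H Hi H' Hi' : Matrix ι ι (smoothRing (J ×ˢ U))}
    (hG : G * Gi = 1) (hG' : G' * Gi' = 1) (hH : H * Hi = 1) (hH' : H' * Hi' = 1)
    (hGH : G.IsHermitian) (hHH : H.IsHermitian)
    (hflow : H.map W.dt = W.curvTrace Gi H Hi)
    (gflow : G.map W.dt = W.curvTrace Gi G Gi + W.torsSq G Gi)
    {g : ℝ → Cn n → Matrix (Fin n) (Fin n) ℂ} {g' : Cn n → Matrix (Fin n) (Fin n) ℂ}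
    {h : ℝ → Cn n → Matrix ι ι ℂ} {h' : Cn n → Matrix ι ι ℂ}
    (sg : ∀ s (hs : s ∈ J), IsMatSlice hs (g s) G) (sg' : ∀ s (hs : s ∈ J), IsMatSlice hs g' G')
    (sh : ∀ s (hs : s ∈ J), IsMatSlice hs (h s) H) (sh' : ∀ s (hs : s ∈ J), IsMatSlice hs h' H')
    {t : ℝ} (ht : t ∈ J) {z : Cn n} (hz : z ∈ U) :
    HasDerivWithinAt (fun s => upsilonNormSq (g s) (h s) h' z)
      (laplacian (g t) (upsilonNormSq (g t) (h t) h') z - gradNormSq (g t) (h t) h' z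
        - gradBarNormSq (g t) (h t) h' z
        + twoRePairing (g t) (h t) h' (torsionCurv (g t) h') z
        + twoRePairing (g t) (h t) h' (upsilonCurv (g t) g' (h t) h') z
        - twoRePairing (g t) (h t) h' (gradCurv (g t) g' h') z) J t := by
  -- The background matrix has the same slice at every time, so its connection coefficients are
  -- constant in time at each point.
  have hΓ' : ∀ i, (W.chernMat H' Hi' i).map W.dt = 0 := by
    intro i
    ext A C : 1
    rw [hW]
    refine dt_eq hJ hJ' hU fun s hs w hw => ⟨fun _ => chern h' i A C w, fun r hr => ?_, ?_⟩
    · exact isSecSlice_chern hJ hJ' hU (sh' r hr) hH' i A C w hw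
    · rw [Matrix.zero_apply, map_zero]
      exact hasDerivWithinAt_const _ _ _
  obtain ⟨Υ, hΥ⟩ : ∃ Υ : Fin n → Matrix ι ι (smoothRing (J ×ˢ U)),
    ∀ i, Υ i = W.chernMat H Hi i - W.chernMat H' Hi' i := ⟨_, fun _ => rfl⟩
  have sΥ : ∀ s (hs : s ∈ J),
      IsSecSlice hs (upsilon (h s) h') Υ := by
    intro s hs
    rw [funext hΥ, hW]
    exact isSecSlice_upsilon hJ hJ' hU (sh s hs) hH (sh' s hs) hH'
  obtain ⟨F₁, h₁⟩ : ∃ F₁ : Fin n → Matrix ι ι (smoothRing (J ×ˢ U)), ∀ i,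
    F₁ i = ∑ k, ∑ l, Gi k l • ∑ p, W.tors G Gi i l p • W.curvMat H' Hi' k p := ⟨_, fun _ => rfl⟩
  obtain ⟨F₂, h₂⟩ : ∃ F₂ : Fin n → Matrix ι ι (smoothRing (J ×ˢ U)), ∀ i,
    F₂ i = ∑ k, ∑ l, Gi k l • (
      ∑ p, (W.chernMat G Gi l - W.chernMat G' Gi' l) i p • W.curvMat H' Hi' k p
        + Υ l * W.curvMat H' Hi' k i - W.curvMat H' Hi' k i * Υ l) := ⟨_, fun _ => rfl⟩
  obtain ⟨F₃, h₃⟩ : ∃ F₃ : Fin n → Matrix ι ι (smoothRing (J ×ˢ U)), ∀ i,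
    F₃ i = ∑ k, ∑ l, Gi k l • W.cov G' Gi' H' Hi' l (W.curvMat H' Hi' k) i := ⟨_, fun _ => rfl⟩
  have evo := W.evolution_upsilon G' Gi' hG hH (WirtingerCalculus.isHermitian_inv hG hGH) hHH
    (WirtingerCalculus.isHermitian_inv hH hHH) hflow gflow hΓ' hΥ h₁ h₂ h₃
  have sP := fun s (hs : s ∈ J) => isSlice_pairing (sg s hs) hG (sh s hs) hH
    (sΥ s hs) (sΥ s hs)
  have main := hasDerivWithinAt_ev hJ hJ' hU _ hz (fun s hs => sP s hs z hz) ht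
  have two : ∀ {Φc : Fin n → ι → ι → Cn n → ℂ} {Φ}, IsSecSlice ht Φc Φ →
      twoRePairing (g t) (h t) h' Φc z
        = ev (pt ht hz)
          (tracePairing Gi H Hi Φ Υ + star (tracePairing Gi H Hi Φ Υ)) := by
    intro Φc Φ hΦ
    rw [map_add, ev_star, Complex.add_conj, ← isSlice_pairing (sg t ht) hG
      (sh t ht) hH hΦ (sΥ t ht) z hz]
    rfl
  have two1 := two (Φ := F₁) (by
    rw [funext h₁, hW]
    exact isSecSlice_torsionCurv hJ hJ' hU (sg t ht) hG (sh' t ht) hH')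
  have two2 := two (Φ := F₂) (by
    rw [funext h₂, hW]
    exact isSecSlice_upsilonCurv hJ hJ' hU (sg t ht) hG (sg' t ht) hG' (sh' t ht) hH'
      (sΥ t ht))
  have two3 := two (Φ := F₃) (by
    rw [funext h₃, hW]
    exact isSecSlice_gradCurv hJ hJ' hU (sg t ht) hG (sg' t ht) hG' (sh' t ht) hH')
  have lap : laplacian (g t)
        (upsilonNormSq (g t) (h t) h') z = _ :=
    isSlice_laplacian hJ hJ' hU (sg t ht) hG (sP t ht) z hz
  have grad : gradNormSq (g t) (h t) h' z
      = ev (pt ht hz) (∑ l, ∑ m, Gi m l *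
        tracePairing Gi H Hi (W.cov G Gi H Hi l Υ) (W.cov G Gi H Hi m Υ)) := by
    have sN := fun l => (sΥ t ht).nabla hJ hJ' hU (sg t ht) hG (sh t ht) hH l
    simp only [hW, gradNormSq, normSqHol, map_sum, map_mul, ((sg t ht).inv hG).apply _ _ z hz,
      ← isSlice_pairing (sg t ht) hG (sh t ht) hH (sN _) (sN _) z hz]
  have gradBar : gradBarNormSq (g t) (h t) h' z
      = ev (pt ht hz) (∑ k, ∑ m, Gi k m * tracePairing Gi H Hi
            (fun i => (Υ i).map (W.db k) + W.torsMul G Gi Υ k i)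
            (fun i => (Υ i).map (W.db m) + W.torsMul G Gi Υ m i)) := by
    have sN : ∀ k, IsSecSlice ht
        (fun i A B w => nablaBar k (upsilon (h t) h') i A B w
          + torsionDot (g t) (h t) h' k i A B w)
        (fun i => (Υ i).map (W.db k) + W.torsMul G Gi Υ k i) := by
      intro k i A B w hw
      simp only [hW, Matrix.add_apply, map_add]
      rw [← (sΥ t ht).nablaBar hJ hJ' hU k i A B w hw,
        ← isSecSlice_torsionDot hJ hJ' hU (sg t ht) hG (sΥ t ht) k i A B w hw]
    simp only [gradBarNormSq, normSqAnti, map_sum, map_mul, ((sg t ht).inv hG).apply _ _ z hz,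
      ← isSlice_pairing (sg t ht) hG (sh t ht) hH (sN _) (sN _) z hz]
  rw [← hW] at main lap
  refine main.congr_deriv ?_
  rw [evo, two1, two2, two3, grad, gradBar, lap]
  simp only [map_add, map_sub]

end smoothRing

end PCF

end

open PCF
theorem proposition3p3 {n : ℕ} {M : Type*} [TopologicalSpace M] [ChartedSpace (Cn n) M]
    [IsManifold 𝓘(ℂ, Cn n) ω M]
    (J : Set ℝ) (hJ : J.OrdConnected) (hJ' : J.Nontrivial)
    (g : ℝ → HermitianMetric n M) (b : ℝ → TwoZeroForm n M) (hflow : IsPluriclosedFlow J g b)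
    (g' : HermitianMetric n M) (b' : TwoZeroForm n M)
    (e : OpenPartialHomeomorph M (Cn n)) (he : e ∈ holCharts n M)
    (z : Cn n) (hz : z ∈ e.target) (t : ℝ) (ht : t ∈ J) :
    HasDerivWithinAt
      (fun s => upsilonNormSq ((g s).comp e) (genComp (g s) (b s) e) (genComp g' b' e) z)
      (laplacian ((g t).comp e)
          (upsilonNormSq ((g t).comp e) (genComp (g t) (b t) e) (genComp g' b' e)) z
        - gradNormSq ((g t).comp e) (genComp (g t) (b t) e) (genComp g' b' e) z
        - gradBarNormSq ((g t).comp e) (genComp (g t) (b t) e) (genComp g' b' e) z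
        + twoRePairing ((g t).comp e) (genComp (g t) (b t) e) (genComp g' b' e)
            (torsionCurv ((g t).comp e) (genComp g' b' e)) z
        + twoRePairing ((g t).comp e) (genComp (g t) (b t) e) (genComp g' b' e)
            (upsilonCurv ((g t).comp e) (g'.comp e) (genComp (g t) (b t) e) (genComp g' b' e)) z
        - twoRePairing ((g t).comp e) (genComp (g t) (b t) e) (genComp g' b' e)
            (gradCurv ((g t).comp e) (g'.comp e) (genComp g' b' e)) z)
      J t := by
  have hU := e.open_target
  have hF := hflow.isFlow hJ hJ' he
  obtain ⟨W, hW⟩ : ∃ W, W = smoothRing.calculus hJ hJ' hU := ⟨_, rfl⟩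
  obtain ⟨G, hGdef⟩ : ∃ G, G = hflow.metricMat he := ⟨_, rfl⟩
  obtain ⟨B, hBdef⟩ : ∃ B, B = hflow.potentialMat he := ⟨_, rfl⟩
  obtain ⟨G', hG'def⟩ : ∃ G', G' = g'.constMat J he := ⟨_, rfl⟩
  obtain ⟨B', hB'def⟩ : ∃ B', B' = b'.constMat J he := ⟨_, rfl⟩
  have hG : G * G⁻¹ = 1 := hGdef ▸ hflow.metricMat_mul_inv he
  have hG' : G' * G'⁻¹ = 1 := hG'def ▸ g'.constMat_mul_inv J he
  have sg : ∀ s (hs : s ∈ J), smoothRing.IsMatSlice hs ((g s).comp e) G :=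
    fun s hs w hw => hGdef ▸ rfl
  have sb : ∀ s (hs : s ∈ J), smoothRing.IsMatSlice hs ((b s).comp e) B :=
    fun s hs w hw => hBdef ▸ rfl
  have sg' : ∀ s (hs : s ∈ J), smoothRing.IsMatSlice hs (g'.comp e) G' :=
    fun s hs w hw => hG'def ▸ rfl
  have sb' : ∀ s (hs : s ∈ J), smoothRing.IsMatSlice hs (b'.comp e) B' :=
    fun s hs w hw => hB'def ▸ rfl
  rw [← hW, ← hGdef, ← hBdef] at hF
  -- The generalized metrics play the role of the bundle metrics in the general evolution formula.
  obtain ⟨H, hHdef⟩ : ∃ H, H = WirtingerCalculus.genMat G G⁻¹ B := ⟨_, rfl⟩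
  obtain ⟨Hi, hHidef⟩ : ∃ Hi, Hi = WirtingerCalculus.genMatInv G G⁻¹ B := ⟨_, rfl⟩
  obtain ⟨H', hH'def⟩ : ∃ H', H' = WirtingerCalculus.genMat G' G'⁻¹ B' := ⟨_, rfl⟩
  obtain ⟨Hi', hHi'def⟩ : ∃ Hi', Hi' = WirtingerCalculus.genMatInv G' G'⁻¹ B' := ⟨_, rfl⟩
  have hH : H * Hi = 1 := by rw [hHdef, hHidef, WirtingerCalculus.genMat_mul_inv hG]
  have hH' : H' * Hi' = 1 := by rw [hH'def, hHi'def, WirtingerCalculus.genMat_mul_inv hG']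
  have hHH : H.IsHermitian := hHdef ▸ WirtingerCalculus.genMat_isHermitian hG hF.isHermitian
  have sh : ∀ s (hs : s ∈ J), smoothRing.IsMatSlice hs (genComp (g s) (b s) e) H :=
    fun s hs => hHdef ▸ smoothRing.isMatSlice_genMetric (sg s hs) hG (sb s hs)
  have sh' : ∀ s (hs : s ∈ J), smoothRing.IsMatSlice hs (genComp g' b' e) H' :=
    fun s hs => hH'def ▸ smoothRing.isMatSlice_genMetric (sg' s hs) hG' (sb' s hs)
  exact smoothRing.hasDerivWithinAt_upsilonNormSq hJ hJ' hU hW hG hG' hH hH' hF.isHermitian hHH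
    (by rw [hHdef, hHidef]; exact hF.genMat_evolution) hF.metric_evolution sg sg' sh sh' ht hz
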